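/- Let $C>0$, and let $\alpha\ge 0$ be an even and $\beta\ge 1$ an odd integer with $\alpha+\beta>1$. The oscillator $\ddot y+Cy^{\alpha}\dot y^{\beta}+y=0$, written as the planar system $\dot x=-y-Cx^{\beta}y^{\alpha}$, $\dot y=x$, is transformed by the geometric inversion $\Phi(x,y)=(x,y)/(x^2+y^2)$ and multiplication of the resulting vector field by $(u^2+v^2)^{\alpha+\beta}$ into the polynomial system $$\dot u=-v(u^2+v^2)^{\alpha+\beta}+Cu^{\beta}v^{\alpha}(u^2-v^2),\qquad \dot v=u(u^2+v^2)^{\alpha+\beta}+2Cu^{\beta+1}v^{\alpha+1}.$$ Let $\gamma:[0,T)\to\mathbb R^2$, $0<T\le\infty$, be any maximal forward solution of this polynomial system with $\gamma(0)\ne(0,0)$, and let $\Gamma=\gamma([0,T))$ be its forward trajectory. Then: 1. $\Gamma$ is a spiral converging to infinity: $|\gamma(t)|\to\infty$ as $t\to T$, and for some $t_0\in[0,T)$ the arc $\gamma([t_0,T))$ is, up to reflection in the horizontal axis, a curve given in polar coordinates by $r=f(\varphi)$, $\varphi\ge\varphi_1>0$, with $f:[\varphi_1,\infty)\to(0,\infty)$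 continuous, $f(\varphi)\to\infty$ as $\varphi\to\infty$, and $f(\varphi)<f(\varphi+2\pi)$ for all $\varphi\ge\varphi_1$. 2. $\Gamma$ is unbounded and at positive distance from the origin, and its box dimension exists and equals $$\dim_B\Gamma=2\left(1-\frac1{\alpha+\beta}\right).$$ 3. $\Gamma$ is Minkowski nondegenerate. Here, for a nonempty bounded $A\subset\mathbb R^n$ with open $\varepsilon$-neighbourhood $A_\varepsilon$ of Lebesgue measure $|A_\varepsilon|$, and $s\ge0$, the upper and lower Minkowski contents $\mathcal M^{*s}(A)$ and $\mathcal M^{s}_*(A)$ are the $\limsup$ and $\liminf$ of $|A_\varepsilon|/\varepsilon^{n-s}$ as $\varepsilon\to0^+$. The upper and lower box dimensions of $A$ are $\inf\{s>0:\mathcal M^{*s}(A)=0\}$ and $\inf\{s>0:\mathcal M^{s}_*(A)=0\}$; the box dimension exists if they coincide, and is then the common value. The set $A$ is Minkowski nondegenerate if $0<\mathcal M^d_*(A)\le\mathcal M^{*d}(A)<\infty$ for some $d\ge0$. For an unbounded set $A$ at positive distance from the origin all these notions are defined as those of the bounded set $\Phi(A)$, where $\Phi(x)=x/|x|^2$.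 -/

import Mathlib

open Set Filter Topology MeasureTheory
open scoped ENNReal

noncomputable section

/-! ### Minkowski content and box dimension -/

/-- Upper `s`-dimensional Minkowski content of a subset of `ℝⁿ`:
`limsup_{ε → 0+} |A_ε| / ε^(n-s)`, with `A_ε` the open Euclidean `ε`-neighbourhood of `A`. -/
def upperMinkowskiContent {n : ℕ} (s : ℝ) (A : Set (EuclideanSpace ℝ (Fin n))) : ℝ≥0∞ :=
  limsup (fun ε : ℝ => volume (Metric.thickening ε A) / ENNReal.ofReal (ε ^ ((n : ℝ) - s)))
    (𝓝[>] (0 : ℝ))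

/-- Lower `s`-dimensional Minkowski content of a subset of `ℝⁿ`. -/
def lowerMinkowskiContent {n : ℕ} (s : ℝ) (A : Set (EuclideanSpace ℝ (Fin n))) : ℝ≥0∞ :=
  liminf (fun ε : ℝ => volume (Metric.thickening ε A) / ENNReal.ofReal (ε ^ ((n : ℝ) - s)))
    (𝓝[>] (0 : ℝ))

/-- Upper box dimension `inf {s > 0 : M^{*s}(A) = 0}` of a (nonempty) bounded set. -/
def upperBoxDim {n : ℕ} (A : Set (EuclideanSpace ℝ (Fin n))) : ℝ≥0∞ :=
  ⨅ (s : ℝ) (_ : 0 < s) (_ : upperMinkowskiContent s A = 0), ENNReal.ofReal s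

/-- Lower box dimension `inf {s > 0 : M_*^s(A) = 0}` of a (nonempty) bounded set. -/
def lowerBoxDim {n : ℕ} (A : Set (EuclideanSpace ℝ (Fin n))) : ℝ≥0∞ :=
  ⨅ (s : ℝ) (_ : 0 < s) (_ : lowerMinkowskiContent s A = 0), ENNReal.ofReal s

/-- A (nonempty) bounded set is Minkowski nondegenerate if for some `d ≥ 0` its lower and upper
`d`-dimensional Minkowski contents are positive and finite. -/
def IsMinkowskiNondegenerate {n : ℕ} (A : Set (EuclideanSpace ℝ (Fin n))) : Prop :=
  ∃ d : ℝ, 0 ≤ d ∧ 0 < lowerMinkowskiContent d A ∧ upperMinkowskiContent d A < ∞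

/-! ### The same notions for unbounded sets away from the origin -/

/-- The geometric inversion `x ↦ x / |x|²` with respect to the origin. -/
def geomInversion {n : ℕ} (x : EuclideanSpace ℝ (Fin n)) : EuclideanSpace ℝ (Fin n) :=
  (‖x‖ ^ 2)⁻¹ • x

/-- `A` is unbounded and has positive distance from the origin. -/
def IsUnboundedAwayFromOrigin {n : ℕ} (A : Set (EuclideanSpace ℝ (Fin n))) : Prop :=
  ¬ Bornology.IsBounded A ∧ ∃ δ : ℝ, 0 < δ ∧ ∀ a ∈ A, δ ≤ ‖a‖

/-- The box dimension of the unbounded set `A` (away from the origin) is defined and equals `d`: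
the upper and lower box dimensions of its geometric inverse both equal `d`. -/
def HasBoxDimAtInfinity {n : ℕ} (A : Set (EuclideanSpace ℝ (Fin n))) (d : ℝ) : Prop :=
  IsUnboundedAwayFromOrigin A ∧
    upperBoxDim (geomInversion '' A) = ENNReal.ofReal d ∧
    lowerBoxDim (geomInversion '' A) = ENNReal.ofReal d

/-- Minkowski nondegeneracy of an unbounded set `A` away from the origin, through its geometric
inverse. -/
def IsMinkowskiNondegenerateAtInfinity {n : ℕ} (A : Set (EuclideanSpace ℝ (Fin n))) : Prop :=
  IsUnboundedAwayFromOrigin A ∧ IsMinkowskiNondegenerate (geomInversion '' A)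

/-! ### Forward trajectories -/

/-- The time interval `[0, T)`, where `T` may be `+∞`. -/
def forwardInterval (T : EReal) : Set ℝ := {t : ℝ | 0 ≤ t ∧ (t : EReal) < T}

/-- `γ`, restricted to `[0, T)`, is a solution of `γ' = F(γ)` that cannot be extended to a solution
on a longer interval `[0, T')`. Values of `γ` outside `[0, T)` play no role. -/
structure IsMaximalForwardSolution {n : ℕ}
    (F : EuclideanSpace ℝ (Fin n) → EuclideanSpace ℝ (Fin n))
    (T : EReal) (γ : ℝ → EuclideanSpace ℝ (Fin n)) : Prop where
  pos : 0 < T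
  solution : IsIntegralCurveOn γ (fun _ => F) (forwardInterval T)
  maximal : ∀ (T' : EReal) (γ' : ℝ → EuclideanSpace ℝ (Fin n)), T < T' →
    IsIntegralCurveOn γ' (fun _ => F) (forwardInterval T') →
    ¬ EqOn γ' γ (forwardInterval T)

/-! ### Spirals converging to infinity -/

/-- `S` is the spiral `r = f(φ)`, `φ ≥ φ₁ > 0`, in polar coordinates (or its mirror image in the
`x`-axis), where `f > 0` is continuous, tends to infinity and is radially increasing, that is,
`k ↦ f(φ + 2kπ)` is strictly increasing for every `φ ≥ φ₁`. -/
def IsPolarSpiralToInfinity (S : Set (EuclideanSpace ℝ (Fin 2))) : Prop :=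
  ∃ (σ φ₁ : ℝ) (f : ℝ → ℝ), (σ = 1 ∨ σ = -1) ∧ 0 < φ₁ ∧
    ContinuousOn f (Ici φ₁) ∧ (∀ φ ∈ Ici φ₁, 0 < f φ) ∧ Tendsto f atTop atTop ∧
    (∀ φ ∈ Ici φ₁, f φ < f (φ + 2 * Real.pi)) ∧
    S = (fun φ : ℝ => !₂[f φ * Real.cos φ, σ * (f φ * Real.sin φ)]) '' Ici φ₁

/-- The curve `γ`, defined on `[0, T)`, is a spiral converging to infinity: `|γ(t)| → ∞` as
`t → T`, and apart from an initial arc `γ([0, t₀))` the curve is a polar spiral. -/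
def IsSpiralConvergingToInfinity (T : EReal) (γ : ℝ → EuclideanSpace ℝ (Fin 2)) : Prop :=
  (∀ R : ℝ, ∃ t₀ ∈ forwardInterval T, ∀ t ∈ forwardInterval T, t₀ ≤ t → R ≤ ‖γ t‖) ∧
  ∃ t₀ ∈ forwardInterval T, IsPolarSpiralToInfinity (γ '' (forwardInterval T ∩ Ici t₀))

/-! ### The weakly damped oscillator and its geometric inverse -/

/-- The planar system `x' = -y - C x^β y^α`, `y' = x`, equivalent to the oscillator
`y'' + C y^α (y')^β + y = 0`. -/
def oscillatorField (C : ℝ) (α β : ℕ) (p : EuclideanSpace ℝ (Fin 2)) :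
    EuclideanSpace ℝ (Fin 2) :=
  !₂[-p 1 - C * p 0 ^ β * p 1 ^ α, p 0]

/-- The vector field obtained from `P` by the change of variables `u = x / |x|²` (for `u ≠ 0`):
`u' = |u|² P(u/|u|²) - 2 (u · P(u/|u|²)) u`. -/
def invertedField {n : ℕ} (P : EuclideanSpace ℝ (Fin n) → EuclideanSpace ℝ (Fin n))
    (u : EuclideanSpace ℝ (Fin n)) : EuclideanSpace ℝ (Fin n) :=
  ‖u‖ ^ 2 • P (geomInversion u) - (2 * inner ℝ u (P (geomInversion u))) • u

/-- The polynomial system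
`u' = -v (u² + v²)^(α+β) + C u^β v^α (u² - v²)`,
`v' =  u (u² + v²)^(α+β) + 2 C u^(β+1) v^(α+1)`. -/
def invertedOscillatorField (C : ℝ) (α β : ℕ) (p : EuclideanSpace ℝ (Fin 2)) :
    EuclideanSpace ℝ (Fin 2) :=
  !₂[-p 1 * (p 0 ^ 2 + p 1 ^ 2) ^ (α + β) + C * p 0 ^ β * p 1 ^ α * (p 0 ^ 2 - p 1 ^ 2),
     p 0 * (p 0 ^ 2 + p 1 ^ 2) ^ (α + β) + 2 * C * p 0 ^ (β + 1) * p 1 ^ (α + 1)]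

/-- The polynomial system is the geometric inverse of the oscillator, multiplied by the positive
factor `(u² + v²)^(α+β)`. -/
theorem invertedOscillatorField_eq (C : ℝ) (α β : ℕ) (p : EuclideanSpace ℝ (Fin 2))
    (hp : p ≠ 0) :
    invertedOscillatorField C α β p =
      (‖p‖ ^ 2) ^ (α + β) • invertedField (oscillatorField C α β) p := by
  have hn : ‖p‖ ^ 2 = p 0 ^ 2 + p 1 ^ 2 := by
    simp [EuclideanSpace.norm_sq_eq, Fin.sum_univ_two]
  have h0 : p 0 ^ 2 + p 1 ^ 2 ≠ 0 := by
    rw [← hn]; positivity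
  ext i
  fin_cases i
  · simp [invertedOscillatorField, invertedField, oscillatorField, geomInversion, hn,
      PiLp.inner_apply, Fin.sum_univ_two, mul_pow]
    field_simp
    ring
  · simp [invertedOscillatorField, invertedField, oscillatorField, geomInversion, hn,
      PiLp.inner_apply, Fin.sum_univ_two, mul_pow]
    field_simp
    ring

end

/-! Put n = α + β, which is odd and at least 3, and r = |γ|. Along solutions r' = C u^(β+1) v^α r,
which is nonnegative because both exponents are even, while the polar angle has speed θ' = r^(2n) +
C u^β v^(α+1). The obstacle is that r' vanishes on axes, so r alone gives no quantitative growth.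
The remedy is the quartic Q = uv(u² - v²) = r⁴ sin(4φ)/4: where r' vanishes, its derivative is
r^(2n+4) > 0. Adding a small multiple of Q to a radial quantity therefore restores growth at every
angle.

On a compact annulus, r² + δQ grows at a uniform rate, so no global solution is bounded; a bounded
solution with finite T could be extended. Hence r increases to infinity
(`IsMaximalForwardSolution.norm_unbounded`). Far out, θ' ≥ r^(2n)/2 and (log r)' ≤ θ', so θ also
runs to infinity; the angle can replace time as parameter, and strict growth of r gives the spiral.

The dimension is read off the inverted curve w = γ/|γ|², of radius ρ = 1/r. Since -dρ/dθ ≤ 2Cρ^n,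
one turn at radius at most R loses at most 4πC R^n. Up to constants, at scale ε = R^n the
ε-neighbourhood thus contains a full disc of radius comparable to R
(`IsPolarAngle.ball_subset_thickening`). Conversely, the part of w outside radius R has length
O(R^(2-n)), so its neighbourhood has area O(ε R^(2-n)) = O(R²), and the rest lies in a disc of
radius R (`exists_volume_thickening_le`). The length bound again needs the quartic: |w'| is
dominated by the derivative of a multiple of r^(n-2) + κQ/r⁵ (`dist_geomInversion_le`), whose
correction term is bounded. Both area bounds are multiples of R² = ε^(2/n), which gives dimension 2
- 2/n and nondegeneracy together. -/

/-! ### Calculus on intervals -/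

/-- If `‖w'‖ ≤ g'` along an interval, then the increments of `w` are bounded by those of `g`. -/
theorem norm_sub_le_sub_of_hasDerivWithinAt {E : Type*} [NormedAddCommGroup E] [NormedSpace ℝ E]
    {I : Set ℝ} {w w' : ℝ → E} {g g' : ℝ → ℝ} {a b : ℝ} (hI : Icc a b ⊆ I)
    (hw : ∀ t ∈ Icc a b, HasDerivWithinAt w (w' t) I t)
    (hg : ∀ t ∈ Icc a b, HasDerivWithinAt g (g' t) I t)
    (hb : ∀ t ∈ Icc a b, ‖w' t‖ ≤ g' t) (hab : a ≤ b) : ‖w b - w a‖ ≤ g b - g a := by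
  have hmem : ∀ x ∈ Ico a b, I ∈ 𝓝[≥] x := fun x hx =>
    mem_of_superset (Icc_mem_nhdsGE hx.2) ((Icc_subset_Icc_left hx.1).trans hI)
  refine image_norm_le_of_norm_deriv_right_le_deriv_boundary' (f := fun t => w t - w a)
    (f' := w') (B := fun t => g t - g a) (B' := g') (a := a) (b := b) ?_ ?_ (by simp) ?_ ?_ ?_
    (right_mem_Icc.2 hab)
  · exact fun t ht => ((hw t ht).continuousWithinAt.mono hI).sub continuousWithinAt_const
  · exact fun t ht => ((hw t ⟨ht.1, ht.2.le⟩).mono_of_mem_nhdsWithin (hmem t ht)).sub_const _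
  · exact fun t ht => ((hg t ht).continuousWithinAt.mono hI).sub continuousWithinAt_const
  · exact fun t ht => ((hg t ⟨ht.1, ht.2.le⟩).mono_of_mem_nhdsWithin (hmem t ht)).sub_const _
  · exact fun t ht => hb t ⟨ht.1, ht.2.le⟩

theorem le_of_hasDerivWithinAt_nonneg {I : Set ℝ} {g g' : ℝ → ℝ} {a b : ℝ} (hI : Icc a b ⊆ I)
    (hg : ∀ t ∈ Icc a b, HasDerivWithinAt g (g' t) I t)
    (hb : ∀ t ∈ Icc a b, 0 ≤ g' t) (hab : a ≤ b) : g a ≤ g b := by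
  have := norm_sub_le_sub_of_hasDerivWithinAt (w := fun _ => (0 : ℝ)) (w' := fun _ => 0) hI
    (fun t _ => hasDerivWithinAt_const _ _ _) hg (by simpa using hb) hab
  simpa using this

/-! ### Maximal solutions leave bounded sets in finite time -/

theorem forwardInterval_coe (T : ℝ) : forwardInterval (T : EReal) = Ico 0 T := by
  ext t; simp [forwardInterval]

/-- A bounded solution on [0, T) has bounded velocity, so it is Lipschitz and has a limit at T; a
local solution started from that limit would prolong it. -/
theorem IsMaximalForwardSolution.exists_norm_gt {n : ℕ}
    {F : EuclideanSpace ℝ (Fin n) → EuclideanSpace ℝ (Fin n)} (hF : ContDiff ℝ 1 F) {T : ℝ}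
    {γ : ℝ → EuclideanSpace ℝ (Fin n)} (h : IsMaximalForwardSolution F T γ) (R : ℝ) :
    ∃ t ∈ forwardInterval (T : EReal), R < ‖γ t‖ := by
  by_contra! hR
  have hT : 0 < T := by exact_mod_cast h.pos
  have hsol := h.solution
  have hmax := h.maximal
  rw [forwardInterval_coe] at hR hsol hmax
  obtain ⟨M, hM⟩ := (isCompact_closedBall (0 : EuclideanSpace ℝ (Fin n)) R).exists_bound_of_continuousOn
    hF.continuous.continuousOn
  have hM0 : ∀ t ∈ Ico 0 T, ‖F (γ t)‖₊ ≤ M.toNNReal := fun t ht => by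
    rw [← NNReal.coe_le_coe, coe_nnnorm]
    exact (hM _ (by simpa using hR t ht)).trans (Real.le_coe_toNNReal M)
  obtain ⟨g, hgl, hgγ⟩ :=
    ((convex_Ico 0 T).lipschitzOnWith_of_nnnorm_hasDerivWithin_le hsol hM0).extend_finite_dimension
  have hgc := hgl.continuous
  obtain ⟨σ, hσT, ε, hε, hσ⟩ :=
    ContDiffAt.exists_forall_mem_closedBall_exists_eq_forall_mem_Ioo_hasDerivAt₀
      (hF.contDiffAt (x := g T)) T
  have hg' : ∀ t ∈ Ioo 0 T, HasDerivAt g (F (g t)) t := fun t ht => by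
    have h1 := (hsol t ⟨ht.1.le, ht.2⟩).hasDerivAt (Ico_mem_nhds ht.1 ht.2)
    rw [hgγ ⟨ht.1.le, ht.2⟩] at h1
    -- `g` is the global Lipschitz extension of the solution, so `g T` is the limit at time T. The
    -- left derivative there comes from the limit of the derivatives.
    exact h1.congr_of_eventuallyEq (by
      filter_upwards [Ico_mem_nhds ht.1 ht.2] with s hs using (hgγ hs).symm)
  have hgT : HasDerivWithinAt g (F (g T)) (Iic T) T := by
    refine hasDerivWithinAt_Iic_of_tendsto_deriv (s := Ioo 0 T)
      (fun t ht => (hg' t ht).differentiableAt.differentiableWithinAt)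
      hgc.continuousWithinAt (Ioo_mem_nhdsLT hT) ?_
    have : Tendsto (fun t => F (g t)) (𝓝[<] T) (𝓝 (F (g T))) :=
      ((hF.continuous.comp hgc).tendsto T).mono_left nhdsWithin_le_nhds
    refine this.congr' ?_
    filter_upwards [Ioo_mem_nhdsLT hT] with t ht using (hg' t ht).deriv.symm
  set q : ℝ → EuclideanSpace ℝ (Fin n) := fun t => if t < T then γ t else σ t with hq
  have hq1 : ∀ t < T, q t = γ t := fun t ht => by simp [hq, ht]
  have hq2 : ∀ t, T ≤ t → q t = σ t := fun t ht => by simp [hq, ht.not_gt]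
  refine hmax ((T + ε : ℝ) : EReal) q (by exact_mod_cast (by linarith)) ?_
    (fun t ht => hq1 t ht.2)
  rw [forwardInterval_coe]
  intro t ht
  change HasDerivWithinAt q (F (q t)) _ t
  rcases lt_trichotomy t T with h1 | h1 | h1
  · rw [hq1 t h1]
    have h2 : HasDerivWithinAt γ (F (γ t)) (Ico 0 (T + ε)) t :=
      (hsol t ⟨ht.1, h1⟩).mono_of_mem_nhdsWithin (by
        filter_upwards [self_mem_nhdsWithin, nhdsWithin_le_nhds (Iio_mem_nhds h1)] with s hs hs'
          using ⟨hs.1, hs'⟩)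
    refine h2.congr_of_eventuallyEq ?_ (hq1 t h1)
    filter_upwards [nhdsWithin_le_nhds (Iio_mem_nhds h1)] with s hs using hq1 s hs
  · subst h1
    -- At the junction the one-sided derivatives are found separately and agree, both being the
    -- field at the limit point.
    have hσ1 : HasDerivWithinAt q (F (q t)) (Ici t) t := by
      rw [hq2 t le_rfl]
      exact (hσ t ⟨by linarith, by linarith⟩).hasDerivWithinAt.congr (fun s hs => hq2 s hs)
        (hq2 t le_rfl)
    have hσ2 : HasDerivWithinAt q (F (q t)) (Iic t) t := by
      rw [hq2 t le_rfl, hσT]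
      refine hgT.congr_of_eventuallyEq ?_ (by rw [hq2 t le_rfl, hσT])
      filter_upwards [self_mem_nhdsWithin, nhdsWithin_le_nhds (Ioi_mem_nhds hT)] with s hs hs'
      rcases (show s ≤ t from hs).lt_or_eq with h | h
      · rw [hq1 s h, hgγ ⟨le_of_lt hs', h⟩]
      · rw [h, hq2 t le_rfl, hσT]
    have := hσ2.union hσ1
    rw [Iic_union_Ici] at this
    exact this.mono (subset_univ _)
  · rw [hq2 t h1.le]
    refine ((hσ t ⟨by linarith, ht.2⟩).congr_of_eventuallyEq ?_).hasDerivWithinAt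
    filter_upwards [Ioi_mem_nhds h1] with s hs using hq2 s (le_of_lt hs)

/-! ### Minkowski content and box dimension -/

/-- The parameter `g` plays the role of arc length. Cutting its range into cells of length ε, the
points whose parameter lies in one cell are within ε of a chosen representative, so a disc of radius
2ε covers their neighbourhood. No regularity of `S` is needed. -/
theorem volume_thickening_image_le {ι : Type*} {S : Set ι} {c : ι → EuclideanSpace ℝ (Fin 2)}
    {g : ι → ℝ} {a b ε : ℝ} (hc : ∀ x ∈ S, ∀ y ∈ S, dist (c x) (c y) ≤ |g x - g y|)
    (hg : ∀ x ∈ S, g x ∈ Icc a b) (hab : a ≤ b) (hε : 0 < ε) :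
    volume (Metric.thickening ε (c '' S)) ≤
      ENNReal.ofReal (4 * Real.pi * ε * (b - a) + 4 * Real.pi * ε ^ 2) := by
  classical
  set N := ⌊(b - a) / ε⌋₊ + 1 with hN
  let p : ℕ → ι → Prop := fun k x => x ∈ S ∧ ⌊(g x - a) / ε⌋₊ = k
  let B : ℕ → Set (EuclideanSpace ℝ (Fin 2)) := fun k =>
    if h : ∃ x, p k x then Metric.ball (c h.choose) (2 * ε) else ∅
  have hsub : Metric.thickening ε (c '' S) ⊆ ⋃ k ∈ Finset.range N, B k := by
    intro z hz
    obtain ⟨_, ⟨x, hx, rfl⟩, hzx⟩ := Metric.mem_thickening_iff.1 hz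
    set k := ⌊(g x - a) / ε⌋₊ with hk
    have hex : ∃ x, p k x := ⟨x, hx, rfl⟩
    have hkN : k < N := by
      rw [hN, Nat.lt_succ_iff]
      exact Nat.floor_le_floor (by have := (hg x hx).2; gcongr)
    simp only [mem_iUnion, Finset.mem_range]
    refine ⟨k, hkN, ?_⟩
    simp only [B, hex, dif_pos]
    obtain ⟨hyS, hyk⟩ := hex.choose_spec
    set y := hex.choose
    have h1 := Nat.floor_le (div_nonneg (sub_nonneg.2 (hg x hx).1) hε.le)
    have h2 := Nat.lt_floor_add_one ((g x - a) / ε)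
    have h3 := Nat.floor_le (div_nonneg (sub_nonneg.2 (hg y hyS).1) hε.le)
    have h4 := Nat.lt_floor_add_one ((g y - a) / ε)
    rw [← hk] at h1 h2
    rw [hyk] at h3 h4
    rw [le_div_iff₀ hε] at h1 h3
    rw [div_lt_iff₀ hε] at h2 h4
    have h5 : |g x - g y| < ε := by rw [abs_lt]; constructor <;> nlinarith
    rw [Metric.mem_ball]
    linarith [dist_triangle z (c x) (c y), hc x hx y hyS]
  have hB : ∀ k, volume (B k) ≤ ENNReal.ofReal (4 * Real.pi * ε ^ 2) := fun k => by
    by_cases h : ∃ x, p k x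
    · simp only [B, h, dif_pos, EuclideanSpace.volume_ball_fin_two]
      rw [← ENNReal.ofReal_pow (by positivity), ← ENNReal.ofReal_mul (by positivity)]
      exact ENNReal.ofReal_le_ofReal (by ring_nf; rfl)
    · simp [B, h]
  calc volume (Metric.thickening ε (c '' S)) ≤ volume (⋃ k ∈ Finset.range N, B k) :=
        measure_mono hsub
    _ ≤ ∑ k ∈ Finset.range N, volume (B k) := measure_biUnion_finset_le _ _
    _ ≤ ∑ k ∈ Finset.range N, ENNReal.ofReal (4 * Real.pi * ε ^ 2) :=
        Finset.sum_le_sum fun k _ => hB k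
    _ = ENNReal.ofReal (N * (4 * Real.pi * ε ^ 2)) := by
        rw [Finset.sum_const, Finset.card_range, nsmul_eq_mul,
          ENNReal.ofReal_mul N.cast_nonneg, ENNReal.ofReal_natCast]
    _ ≤ _ := by
        refine ENNReal.ofReal_le_ofReal ?_
        have h1 : (N : ℝ) ≤ (b - a) / ε + 1 := by
          rw [hN]; push_cast
          gcongr
          exact Nat.floor_le (div_nonneg (sub_nonneg.2 hab) hε.le)
        calc (N : ℝ) * (4 * Real.pi * ε ^ 2) ≤ ((b - a) / ε + 1) * (4 * Real.pi * ε ^ 2) := by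
              gcongr
          _ = _ := by field_simp

theorem volume_thickening_union_le {A B : Set (EuclideanSpace ℝ (Fin 2))} (ε : ℝ) :
    volume (Metric.thickening ε (A ∪ B)) ≤
      volume (Metric.thickening ε A) + volume (Metric.thickening ε B) := by
  rw [Metric.thickening_union]
  exact measure_union_le _ _

section MinkowskiBounds

variable {A : Set (EuclideanSpace ℝ (Fin 2))} {d c K : ℝ}

theorem upperMinkowskiContent_le
    (hK : ∀ᶠ ε in 𝓝[>] (0 : ℝ), volume (Metric.thickening ε A) ≤ ENNReal.ofReal (K * ε ^ (2 - d))) :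
    upperMinkowskiContent d A ≤ ENNReal.ofReal K := by
  refine limsup_le_of_le (by isBoundedDefault) ?_
  filter_upwards [hK, self_mem_nhdsWithin] with ε h hε
  rw [mem_Ioi] at hε
  refine ENNReal.div_le_of_le_mul (h.trans_eq ?_)
  rw [← ENNReal.ofReal_mul' (by positivity)]
  norm_num

theorem le_lowerMinkowskiContent (hc0 : 0 ≤ c)
    (hc : ∀ᶠ ε in 𝓝[>] (0 : ℝ), ENNReal.ofReal (c * ε ^ (2 - d)) ≤ volume (Metric.thickening ε A)) :
    ENNReal.ofReal c ≤ lowerMinkowskiContent d A := by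
  refine le_liminf_of_le (by isBoundedDefault) ?_
  filter_upwards [hc, self_mem_nhdsWithin] with ε h hε
  rw [mem_Ioi] at hε
  rw [ENNReal.le_div_iff_mul_le (.inl (by simp; positivity)) (.inl (by simp)),
    ← ENNReal.ofReal_mul hc0]
  convert h using 3
  norm_num

theorem upperMinkowskiContent_eq_zero {s : ℝ} (hds : d < s)
    (hK : ∀ᶠ ε in 𝓝[>] (0 : ℝ), volume (Metric.thickening ε A) ≤ ENNReal.ofReal (K * ε ^ (2 - d))) :
    upperMinkowskiContent s A = 0 := by
  have hlim : Tendsto (fun ε : ℝ => ENNReal.ofReal (K * ε ^ (s - d))) (𝓝[>] 0) (𝓝 0) := by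
    have h1 : Tendsto (fun ε : ℝ => ε ^ (s - d)) (𝓝[>] 0) (𝓝 0) := by
      have := (Real.continuousAt_rpow_const 0 (s - d) (.inr (by linarith))).tendsto
      rw [Real.zero_rpow (by linarith)] at this
      exact this.mono_left nhdsWithin_le_nhds
    have := ENNReal.tendsto_ofReal (h1.const_mul K)
    simpa using this
  refine Tendsto.limsup_eq (tendsto_of_tendsto_of_tendsto_of_le_of_le' tendsto_const_nhds hlim
    (Eventually.of_forall fun _ => zero_le) ?_)
  filter_upwards [hK, self_mem_nhdsWithin] with ε h hε
  rw [mem_Ioi] at hε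
  refine ENNReal.div_le_of_le_mul (h.trans_eq ?_)
  rw [← ENNReal.ofReal_mul' (by positivity), mul_assoc, ← Real.rpow_add hε]
  norm_num

theorem lowerMinkowskiContent_pos {s : ℝ} (hsd : s ≤ d) (hc0 : 0 < c)
    (hc : ∀ᶠ ε in 𝓝[>] (0 : ℝ), ENNReal.ofReal (c * ε ^ (2 - d)) ≤ volume (Metric.thickening ε A)) :
    0 < lowerMinkowskiContent s A := by
  refine (ENNReal.ofReal_pos.2 hc0).trans_le (le_lowerMinkowskiContent hc0.le ?_)
  filter_upwards [hc, Ioo_mem_nhdsGT (zero_lt_one' ℝ)] with ε h hε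
  refine le_trans (ENNReal.ofReal_le_ofReal ?_) h
  exact mul_le_mul_of_nonneg_left
    (Real.rpow_le_rpow_of_exponent_ge hε.1 hε.2.le (by linarith)) hc0.le

theorem lowerMinkowskiContent_le_upper (s : ℝ) :
    lowerMinkowskiContent s A ≤ upperMinkowskiContent s A :=
  liminf_le_limsup

/-- A two-sided power law for the area makes the contents vanish above exponent d and stay positive
up to d, so only the two area bounds remain to be proved for the spiral. -/
theorem boxDim_eq_of_volume_bounds (hd : 0 ≤ d) (hc0 : 0 < c)
    (hc : ∀ᶠ ε in 𝓝[>] (0 : ℝ), ENNReal.ofReal (c * ε ^ (2 - d)) ≤ volume (Metric.thickening ε A))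
    (hK : ∀ᶠ ε in 𝓝[>] (0 : ℝ), volume (Metric.thickening ε A) ≤ ENNReal.ofReal (K * ε ^ (2 - d))) :
    upperBoxDim A = ENNReal.ofReal d ∧ lowerBoxDim A = ENNReal.ofReal d ∧
      IsMinkowskiNondegenerate A := by
  have hlow : ENNReal.ofReal d ≤ lowerBoxDim A := by
    refine le_iInf fun s => le_iInf fun _ => le_iInf fun hs => ENNReal.ofReal_le_ofReal ?_
    by_contra! hlt
    exact (lowerMinkowskiContent_pos hlt.le hc0 hc).ne' hs
  have hle : lowerBoxDim A ≤ upperBoxDim A :=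
    le_iInf fun s => le_iInf fun hs0 => le_iInf fun hs => iInf_le_of_le s <| iInf_le_of_le hs0 <|
      iInf_le_of_le (le_antisymm ((lowerMinkowskiContent_le_upper s).trans hs.le) zero_le) le_rfl
  have hup : upperBoxDim A ≤ ENNReal.ofReal d := by
    refine ge_of_tendsto (x := 𝓝[>] d) (f := ENNReal.ofReal)
      ((ENNReal.continuous_ofReal.tendsto d).mono_left nhdsWithin_le_nhds) ?_
    filter_upwards [self_mem_nhdsWithin] with s hs
    exact iInf_le_of_le s <| iInf_le_of_le (hd.trans_lt hs) <|
      iInf_le_of_le (upperMinkowskiContent_eq_zero hs hK) le_rfl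
  exact ⟨le_antisymm hup (hlow.trans hle), le_antisymm (hle.trans hup) hlow, d, hd,
    lowerMinkowskiContent_pos le_rfl hc0 hc,
    (upperMinkowskiContent_le hK).trans_lt ENNReal.ofReal_lt_top⟩

end MinkowskiBounds

/-- If `P ≥ 0` and `H > 0` wherever `P` vanishes on a compact set, then some combination
`P + δ H` is uniformly positive. -/
theorem IsCompact.exists_add_mul_ge {X : Type*} [TopologicalSpace X] {s : Set X} (hs : IsCompact s)
    {P H : X → ℝ} (hP : ContinuousOn P s) (hH : ContinuousOn H s) (hP0 : ∀ x ∈ s, 0 ≤ P x)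
    (hPH : ∀ x ∈ s, P x = 0 → 0 < H x) :
    ∃ δ > 0, ∃ c > 0, ∀ x ∈ s, c ≤ P x + δ * H x := by
  rcases s.eq_empty_or_nonempty with rfl | hne
  · exact ⟨1, one_pos, 1, one_pos, by simp⟩
  obtain ⟨M, hM⟩ := hs.exists_bound_of_continuousOn hH
  -- The minimum m of max(P, H) is positive. With δB = m/2, where -B bounds H from below, either P ≥
  -- m absorbs the loss or H ≥ m gives the gain.
  obtain ⟨x₀, hx₀, hmin⟩ := hs.exists_isMinOn hne (hP.sup hH)
  set m := max (P x₀) (H x₀) with hm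
  have hm0 : 0 < m := by
    rcases (hP0 x₀ hx₀).eq_or_lt' with h | h
    · exact lt_max_of_lt_right (hPH x₀ hx₀ h)
    · exact lt_max_of_lt_left h
  have hmx : ∀ x ∈ s, m ≤ max (P x) (H x) := fun x hx => hmin hx
  set B := max M 1 with hB
  have hB0 : 0 < B := lt_max_of_lt_right one_pos
  set δ := m / (2 * B) with hδ
  have hδ0 : 0 < δ := by positivity
  refine ⟨δ, hδ0, min (m / 2) (δ * m), by positivity, fun x hx => ?_⟩
  rcases le_max_iff.1 (hmx x hx) with h | h
  · have h1 : -B ≤ H x := by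
      have := (abs_le.1 (hM x hx)).1
      linarith [le_max_left M 1]
    have h2 : δ * B = m / 2 := by rw [hδ]; field_simp
    have h3 := mul_le_mul_of_nonneg_left h1 hδ0.le
    exact (min_le_left _ _).trans (by linarith)
  · have h3 := mul_le_mul_of_nonneg_left h hδ0.le
    exact (min_le_right _ _).trans (by linarith [hP0 x hx])

/-! ### Solutions of the inverted oscillator -/

theorem EuclideanSpace.norm_sq_fin_two (p : EuclideanSpace ℝ (Fin 2)) :
    ‖p‖ ^ 2 = p 0 ^ 2 + p 1 ^ 2 := by
  simp [EuclideanSpace.norm_sq_eq, Fin.sum_univ_two]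

theorem EuclideanSpace.abs_apply_le_norm (p : EuclideanSpace ℝ (Fin 2)) (i : Fin 2) :
    |p i| ≤ ‖p‖ := PiLp.norm_apply_le p i

theorem EuclideanSpace.norm_le_abs_add_abs (p : EuclideanSpace ℝ (Fin 2)) :
    ‖p‖ ≤ |p 0| + |p 1| := by
  refine abs_le_of_sq_le_sq' ?_ (by positivity) |>.2
  rw [EuclideanSpace.norm_sq_fin_two]
  nlinarith [sq_abs (p 0), sq_abs (p 1), abs_nonneg (p 0), abs_nonneg (p 1),
    mul_nonneg (abs_nonneg (p 0)) (abs_nonneg (p 1))]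

theorem abs_pow_mul_pow_le {x y s : ℝ} (hx : |x| ≤ s) (hy : |y| ≤ s) (a b : ℕ) :
    |x ^ a * y ^ b| ≤ s ^ (a + b) := by
  rw [abs_mul, abs_pow, abs_pow, pow_add]
  have := (abs_nonneg x).trans hx
  gcongr

theorem ordConnected_forwardInterval (T : EReal) : (forwardInterval T).OrdConnected :=
  ⟨fun _ ha _ hb _ hx => ⟨ha.1.trans hx.1, (EReal.coe_le_coe_iff.2 hx.2).trans_lt hb.2⟩⟩

theorem Icc_subset_forwardInterval {T : EReal} {a b : ℝ} (ha : 0 ≤ a)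
    (hb : b ∈ forwardInterval T) : Icc a b ⊆ forwardInterval T :=
  fun _ hx => ⟨ha.trans hx.1, (EReal.coe_le_coe_iff.2 hx.2).trans_lt hb.2⟩

theorem contDiff_invertedOscillatorField (C : ℝ) (α β : ℕ) :
    ContDiff ℝ 1 (invertedOscillatorField C α β) := by
  rw [contDiff_euclidean]
  have h : ∀ i : Fin 2, ContDiff ℝ 1 fun p : EuclideanSpace ℝ (Fin 2) => p i :=
    contDiff_euclidean.1 contDiff_id
  have h0 := h 0
  have h1 := h 1
  intro i
  fin_cases i
  · simp only [invertedOscillatorField]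
    exact (h1.neg.mul (((h0.pow 2).add (h1.pow 2)).pow _)).add
      (((contDiff_const.mul (h0.pow β)).mul (h1.pow α)).mul ((h0.pow 2).sub (h1.pow 2)))
  · simp only [invertedOscillatorField]
    exact (h0.mul (((h0.pow 2).add (h1.pow 2)).pow _)).add
      (((contDiff_const.mul (h0.pow (β + 1))).mul (h1.pow (α + 1))))

section Solution

variable {C : ℝ} {α β : ℕ} {I : Set ℝ} {γ : ℝ → EuclideanSpace ℝ (Fin 2)}

theorem hasDerivWithinAt_fst
    (h : IsIntegralCurveOn γ (fun _ => invertedOscillatorField C α β) I) {t : ℝ} (ht : t ∈ I) :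
    HasDerivWithinAt (fun t => γ t 0) (-γ t 1 * (γ t 0 ^ 2 + γ t 1 ^ 2) ^ (α + β)
      + C * γ t 0 ^ β * γ t 1 ^ α * (γ t 0 ^ 2 - γ t 1 ^ 2)) I t := by
  simpa [invertedOscillatorField] using!
    (EuclideanSpace.proj 0 : EuclideanSpace ℝ (Fin 2) →L[ℝ] ℝ).hasFDerivAt.comp_hasDerivWithinAt t
      (h t ht)

theorem hasDerivWithinAt_snd
    (h : IsIntegralCurveOn γ (fun _ => invertedOscillatorField C α β) I) {t : ℝ} (ht : t ∈ I) :
    HasDerivWithinAt (fun t => γ t 1) (γ t 0 * (γ t 0 ^ 2 + γ t 1 ^ 2) ^ (α + β)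
      + 2 * C * γ t 0 ^ (β + 1) * γ t 1 ^ (α + 1)) I t := by
  simpa [invertedOscillatorField] using!
    (EuclideanSpace.proj 1 : EuclideanSpace ℝ (Fin 2) →L[ℝ] ℝ).hasFDerivAt.comp_hasDerivWithinAt t
      (h t ht)

theorem hasDerivWithinAt_norm_sq
    (h : IsIntegralCurveOn γ (fun _ => invertedOscillatorField C α β) I) {t : ℝ} (ht : t ∈ I) :
    HasDerivWithinAt (fun t => ‖γ t‖ ^ 2)
      (2 * C * (γ t 0 ^ (β + 1) * γ t 1 ^ α) * ‖γ t‖ ^ 2) I t := by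
  simp only [EuclideanSpace.norm_sq_fin_two]
  convert! ((hasDerivWithinAt_fst h ht).pow 2).add ((hasDerivWithinAt_snd h ht).pow 2) using 1
  push_cast
  ring

theorem hasDerivWithinAt_norm
    (h : IsIntegralCurveOn γ (fun _ => invertedOscillatorField C α β) I) {t : ℝ} (ht : t ∈ I)
    (h0 : γ t ≠ 0) :
    HasDerivWithinAt (fun t => ‖γ t‖) (C * (γ t 0 ^ (β + 1) * γ t 1 ^ α) * ‖γ t‖) I t := by
  have hn : 0 < ‖γ t‖ := norm_pos_iff.2 h0
  have := (hasDerivWithinAt_norm_sq h ht).sqrt (by positivity)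
  simp only [Real.sqrt_sq (norm_nonneg _)] at this
  convert this using 1
  field_simp

/-- In polar coordinates, the function differentiated here is `r⁴ sin (4φ) / 4`. -/
theorem hasDerivWithinAt_quartic
    (h : IsIntegralCurveOn γ (fun _ => invertedOscillatorField C α β) I) {t : ℝ} (ht : t ∈ I) :
    HasDerivWithinAt (fun t => γ t 0 * γ t 1 * (γ t 0 ^ 2 - γ t 1 ^ 2))
      ((‖γ t‖ ^ 2) ^ (α + β) * ((‖γ t‖ ^ 2) ^ 2 - 8 * (γ t 0 * γ t 1) ^ 2)
        + C * (γ t 0 ^ β * γ t 1 ^ (α + 1)) *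
          (5 * γ t 0 ^ 4 - 10 * γ t 0 ^ 2 * γ t 1 ^ 2 + γ t 1 ^ 4)) I t := by
  have hu := hasDerivWithinAt_fst h ht
  have hv := hasDerivWithinAt_snd h ht
  convert! (hu.mul hv).mul ((hu.pow 2).sub (hv.pow 2)) using 1
  simp only [Pi.pow_apply, Pi.mul_apply, Pi.sub_apply, EuclideanSpace.norm_sq_fin_two]
  push_cast
  ring

theorem radial_factor_nonneg (hα : Even α) (hβ : Odd β) (x y : ℝ) : 0 ≤ x ^ (β + 1) * y ^ α :=
  mul_nonneg (hβ.add_one.pow_nonneg x) (hα.pow_nonneg y)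

theorem norm_le_norm_of_le (hC : 0 < C) (hα : Even α) (hβ : Odd β)
    (h : IsIntegralCurveOn γ (fun _ => invertedOscillatorField C α β) I) {a b : ℝ}
    (hI : Icc a b ⊆ I) (hab : a ≤ b) : ‖γ a‖ ≤ ‖γ b‖ := by
  have := le_of_hasDerivWithinAt_nonneg hI (fun t ht => hasDerivWithinAt_norm_sq h (hI ht))
    (fun t _ => by have := radial_factor_nonneg hα hβ (γ t 0) (γ t 1); positivity) hab
  exact (sq_le_sq₀ (norm_nonneg _) (norm_nonneg _)).1 this

/-- If the radial factor vanishes then uv = 0, and only the rotational term r^(2n+4) survives. -/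
theorem quartic_deriv_pos (hβ : Odd β) {p : EuclideanSpace ℝ (Fin 2)}
    (hp : p ≠ 0) (h0 : p 0 ^ (β + 1) * p 1 ^ α = 0) :
    0 < (‖p‖ ^ 2) ^ (α + β) * ((‖p‖ ^ 2) ^ 2 - 8 * (p 0 * p 1) ^ 2)
        + C * (p 0 ^ β * p 1 ^ (α + 1)) *
          (5 * p 0 ^ 4 - 10 * p 0 ^ 2 * p 1 ^ 2 + p 1 ^ 4) := by
  have hn : 0 < ‖p‖ := norm_pos_iff.2 hp
  have huv : p 0 * p 1 = 0 := by
    rcases mul_eq_zero.1 h0 with h | h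
    · rw [eq_zero_of_pow_eq_zero h, zero_mul]
    · rw [eq_zero_of_pow_eq_zero h, mul_zero]
  have huv' : p 0 ^ β * p 1 ^ (α + 1) = 0 := by
    rcases mul_eq_zero.1 huv with h | h
    · rw [h, zero_pow hβ.pos.ne', zero_mul]
    · rw [h, zero_pow (Nat.succ_ne_zero α), mul_zero]
  rw [huv, huv']
  simp only [ne_eq, OfNat.ofNat_ne_zero, not_false_eq_true, zero_pow, mul_zero, sub_zero, zero_mul,
    add_zero]
  positivity

theorem ne_zero_of_le (hC : 0 < C) (hα : Even α) (hβ : Odd β)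
    (h : IsIntegralCurveOn γ (fun _ => invertedOscillatorField C α β) I) {a b : ℝ}
    (hI : Icc a b ⊆ I) (hab : a ≤ b) (h0 : γ a ≠ 0) : γ b ≠ 0 :=
  norm_pos_iff.1 ((norm_pos_iff.2 h0).trans_le (norm_le_norm_of_le hC hα hβ h hI hab))

/-- Equality would make the norm constant in between, so the radial factor, and with it the quartic,
would vanish identically there, against `quartic_deriv_pos`. -/
theorem norm_lt_norm_of_lt (hC : 0 < C) (hα : Even α) (hβ : Odd β)
    (h : IsIntegralCurveOn γ (fun _ => invertedOscillatorField C α β) I) {a b : ℝ}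
    (hI : Icc a b ⊆ I) (hab : a < b) (h0 : γ a ≠ 0) : ‖γ a‖ < ‖γ b‖ := by
  refine (norm_le_norm_of_le hC hα hβ h hI hab.le).lt_of_ne fun heq => ?_
  have hconst : ∀ t ∈ Icc a b, ‖γ t‖ = ‖γ a‖ := fun t ht => le_antisymm
    (heq ▸ norm_le_norm_of_le hC hα hβ h ((Icc_subset_Icc_left ht.1).trans hI) ht.2)
    (norm_le_norm_of_le hC hα hβ h ((Icc_subset_Icc_right ht.2).trans hI) ht.1)
  have hne : ∀ t ∈ Icc a b, γ t ≠ 0 := fun t ht => by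
    rw [← norm_pos_iff, hconst t ht]; exact norm_pos_iff.2 h0
  have hderiv : ∀ {f : ℝ → ℝ} {f' c t : ℝ}, t ∈ Ioo a b → HasDerivWithinAt f f' I t →
      (∀ s ∈ Ioo a b, f s = c) → f' = 0 := by
    intro f f' c t ht hf hfc
    have h1 : HasDerivAt f f' t :=
      hf.hasDerivAt (mem_of_superset (Icc_mem_nhds ht.1 ht.2) hI)
    have h2 : HasDerivAt f 0 t := (hasDerivAt_const t c).congr_of_eventuallyEq (by
      filter_upwards [Ioo_mem_nhds ht.1 ht.2] with s hs using hfc s hs)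
    exact h1.unique h2
  have hP : ∀ t ∈ Ioo a b, γ t 0 ^ (β + 1) * γ t 1 ^ α = 0 := fun t ht => by
    have htI := Ioo_subset_Icc_self ht
    have := hderiv ht (hasDerivWithinAt_norm h (hI htI) (hne t htI))
      (fun s hs => hconst s (Ioo_subset_Icc_self hs))
    have hn := norm_ne_zero_iff.2 (hne t htI)
    simpa [hC.ne', hn] using this
  obtain ⟨t, ht⟩ := exists_between hab
  have h1 := hderiv (c := 0) ht (hasDerivWithinAt_quartic h (hI (Ioo_subset_Icc_self ht)))
    (fun s hs => by
      rcases mul_eq_zero.1 (hP s hs) with h | h <;> simp [eq_zero_of_pow_eq_zero h])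
  exact (quartic_deriv_pos hβ (hne t (Ioo_subset_Icc_self ht))
    (hP t ht)).ne' h1

/-- A solution that exists for all positive times leaves every ball. -/
theorem exists_norm_gt_of_global (hC : 0 < C) (hα : Even α) (hβ : Odd β)
    (h : IsIntegralCurveOn γ (fun _ => invertedOscillatorField C α β) (Ici 0)) (h0 : γ 0 ≠ 0)
    (R : ℝ) : ∃ t ∈ Ici (0 : ℝ), R < ‖γ t‖ := by
  by_contra! hR
  have hsub : ∀ t : ℝ, Icc 0 t ⊆ Ici 0 := fun t => Icc_subset_Ici_self
  set K : Set (EuclideanSpace ℝ (Fin 2)) := Metric.closedBall 0 R ∩ {p | ‖γ 0‖ ≤ ‖p‖} with hK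
  have hKc : IsCompact K :=
    (isCompact_closedBall _ _).inter_right (isClosed_le continuous_const continuous_norm)
  have hγK : ∀ t ∈ Ici (0 : ℝ), γ t ∈ K := fun t ht =>
    ⟨by simpa using hR t ht, norm_le_norm_of_le hC hα hβ h (hsub t) ht⟩
  obtain ⟨δ, hδ, c, hc, hbd⟩ := hKc.exists_add_mul_ge
    (P := fun p => 2 * C * (p 0 ^ (β + 1) * p 1 ^ α) * ‖p‖ ^ 2)
    (H := fun p => (‖p‖ ^ 2) ^ (α + β) * ((‖p‖ ^ 2) ^ 2 - 8 * (p 0 * p 1) ^ 2)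
        + C * (p 0 ^ β * p 1 ^ (α + 1)) * (5 * p 0 ^ 4 - 10 * p 0 ^ 2 * p 1 ^ 2 + p 1 ^ 4))
    (by fun_prop) (by fun_prop)
    (fun p _ => by have := radial_factor_nonneg hα hβ (p 0) (p 1); positivity)
    (fun p hp hp0 => by
      have hn : 0 < ‖p‖ := (norm_pos_iff.2 h0).trans_le hp.2
      exact quartic_deriv_pos hβ (norm_pos_iff.1 hn)
        (by simpa [hC.ne', hn.ne'] using hp0))
  set V : ℝ → ℝ := fun t => ‖γ t‖ ^ 2 + δ * (γ t 0 * γ t 1 * (γ t 0 ^ 2 - γ t 1 ^ 2)) with hV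
  have hVlow : ∀ t ∈ Ici (0 : ℝ), c * t ≤ V t - V 0 := fun t ht => by
    have := norm_sub_le_sub_of_hasDerivWithinAt (w := fun t : ℝ => c * t) (w' := fun _ => c)
      (g := V) (hsub t) (fun s _ => by simpa using ((hasDerivAt_id s).const_mul c).hasDerivWithinAt)
      (fun s hs => (hasDerivWithinAt_norm_sq h (hsub t hs)).add
        ((hasDerivWithinAt_quartic h (hsub t hs)).const_mul δ))
      (fun s hs => by
        rw [Real.norm_of_nonneg hc.le]; exact hbd _ (hγK s (hsub t hs))) ht
    simp only [mul_zero, sub_zero] at this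
    exact (le_abs_self _).trans this
  obtain ⟨M, hM⟩ := hKc.exists_bound_of_continuousOn
    (f := fun p => ‖p‖ ^ 2 + δ * (p 0 * p 1 * (p 0 ^ 2 - p 1 ^ 2))) (by fun_prop)
  have hVM : ∀ t ∈ Ici (0 : ℝ), |V t| ≤ M := fun t ht => hM _ (hγK t ht)
  have hM0 : 0 ≤ M := (abs_nonneg _).trans (hVM 0 self_mem_Ici)
  -- `V` grows at rate at least c, so by this time it has gained 2M + 1, more than |V| ≤ M allows.
  have ht : (0 : ℝ) ≤ (2 * M + 1) / c := by positivity
  have h1 := hVlow _ ht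
  rw [mul_div_cancel₀ _ hc.ne'] at h1
  linarith [abs_le.1 (hVM _ ht), abs_le.1 (hVM 0 self_mem_Ici)]

theorem IsMaximalForwardSolution.norm_unbounded (hC : 0 < C) (hα : Even α) (hβ : Odd β)
    {T : EReal} (h : IsMaximalForwardSolution (invertedOscillatorField C α β) T γ) (h0 : γ 0 ≠ 0)
    (R : ℝ) : ∃ t ∈ forwardInterval T, R < ‖γ t‖ := by
  have hpos := h.pos
  induction T with
  | bot => simp at hpos
  | coe T => exact h.exists_norm_gt (contDiff_invertedOscillatorField C α β) R
  | top =>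
    have hI : forwardInterval ⊤ = Ici 0 := by ext t; simp [forwardInterval, EReal.coe_lt_top]
    have hs := h.solution
    rw [hI] at hs ⊢
    exact exists_norm_gt_of_global hC hα hβ hs h0 R

theorem hasDerivWithinAt_geomInversion
    (h : IsIntegralCurveOn γ (fun _ => invertedOscillatorField C α β) I) {t : ℝ} (ht : t ∈ I)
    (h0 : γ t ≠ 0) :
    HasDerivWithinAt (fun t => geomInversion (γ t))
      ((‖γ t‖ ^ 2)⁻¹ • invertedOscillatorField C α β (γ t)
        + (-(2 * C * (γ t 0 ^ (β + 1) * γ t 1 ^ α) * ‖γ t‖ ^ 2) / (‖γ t‖ ^ 2) ^ 2) • γ t) I t := by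
  have hn : 0 < ‖γ t‖ := norm_pos_iff.2 h0
  exact ((hasDerivWithinAt_norm_sq h ht).inv (by positivity)).smul (h t ht)

theorem norm_invertedOscillatorField_le (hC : 0 < C) (p : EuclideanSpace ℝ (Fin 2)) :
    ‖invertedOscillatorField C α β p‖ ≤
      2 * (‖p‖ * (‖p‖ ^ 2) ^ (α + β)) + 4 * C * ‖p‖ ^ (α + β) * ‖p‖ ^ 2 := by
  have h0 := EuclideanSpace.abs_apply_le_norm p 0
  have h1 := EuclideanSpace.abs_apply_le_norm p 1
  have hn := EuclideanSpace.norm_sq_fin_two p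
  refine (EuclideanSpace.norm_le_abs_add_abs _).trans ?_
  simp only [invertedOscillatorField, ← hn]
  have hm1 : |p 0 ^ β * p 1 ^ α| ≤ ‖p‖ ^ (α + β) := by
    rw [add_comm]; exact abs_pow_mul_pow_le h0 h1 β α
  have hm2 : |p 0 ^ (β + 1) * p 1 ^ (α + 1)| ≤ ‖p‖ ^ (α + β) * ‖p‖ ^ 2 := by
    refine (abs_pow_mul_pow_le h0 h1 (β + 1) (α + 1)).trans_eq ?_
    rw [← pow_add]; congr 1; ring
  have hm3 : |p 0 ^ 2 - p 1 ^ 2| ≤ ‖p‖ ^ 2 := by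
    rw [hn, abs_le]; constructor <;> nlinarith [sq_nonneg (p 0), sq_nonneg (p 1)]
  have e1 : |-p 1 * (‖p‖ ^ 2) ^ (α + β) + C * p 0 ^ β * p 1 ^ α * (p 0 ^ 2 - p 1 ^ 2)| ≤
      ‖p‖ * (‖p‖ ^ 2) ^ (α + β) + C * (‖p‖ ^ (α + β) * ‖p‖ ^ 2) := by
    refine (abs_add_le _ _).trans (add_le_add ?_ ?_)
    · rw [abs_mul, abs_neg, abs_of_nonneg (by positivity : 0 ≤ (‖p‖ ^ 2) ^ (α + β))]
      gcongr
    · rw [show C * p 0 ^ β * p 1 ^ α * (p 0 ^ 2 - p 1 ^ 2)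
        = C * ((p 0 ^ β * p 1 ^ α) * (p 0 ^ 2 - p 1 ^ 2)) by ring, abs_mul, abs_of_pos hC, abs_mul]
      gcongr
  have e2 : |p 0 * (‖p‖ ^ 2) ^ (α + β) + 2 * C * p 0 ^ (β + 1) * p 1 ^ (α + 1)| ≤
      ‖p‖ * (‖p‖ ^ 2) ^ (α + β) + 2 * C * (‖p‖ ^ (α + β) * ‖p‖ ^ 2) := by
    refine (abs_add_le _ _).trans (add_le_add ?_ ?_)
    · rw [abs_mul, abs_of_nonneg (by positivity : 0 ≤ (‖p‖ ^ 2) ^ (α + β))]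
      gcongr
    · rw [show 2 * C * p 0 ^ (β + 1) * p 1 ^ (α + 1)
        = 2 * C * (p 0 ^ (β + 1) * p 1 ^ (α + 1)) by ring, abs_mul, abs_of_pos (by positivity)]
      gcongr
  have hpos : 0 ≤ C * (‖p‖ ^ (α + β) * ‖p‖ ^ 2) := by positivity
  simp only [Matrix.cons_val_zero, Matrix.cons_val_one]
  linarith

end Solution

/-! ### Arc length of the inverted solution -/

section Solution

variable {C : ℝ} {α β : ℕ} {I : Set ℝ} {γ : ℝ → EuclideanSpace ℝ (Fin 2)}

theorem norm_deriv_geomInversion_le (hC : 0 < C) (hαβ : 1 < α + β)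
    {p : EuclideanSpace ℝ (Fin 2)} (hp : p ≠ 0) :
    ‖(‖p‖ ^ 2)⁻¹ • invertedOscillatorField C α β p
        + (-(2 * C * (p 0 ^ (β + 1) * p 1 ^ α) * ‖p‖ ^ 2) / (‖p‖ ^ 2) ^ 2) • p‖ ≤
      2 * ‖p‖ ^ (2 * (α + β) - 1) + 6 * C * ‖p‖ ^ (α + β) := by
  have hn : 0 < ‖p‖ := norm_pos_iff.2 hp
  have hm := abs_pow_mul_pow_le (EuclideanSpace.abs_apply_le_norm p 0)
    (EuclideanSpace.abs_apply_le_norm p 1) (β + 1) α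
  rw [show β + 1 + α = (α + β) + 1 by ring] at hm
  obtain ⟨k, hk⟩ : ∃ k, α + β = k + 2 := ⟨α + β - 2, by omega⟩
  have hF := norm_invertedOscillatorField_le (α := α) (β := β) hC p
  rw [hk] at hm hF ⊢
  have e1 : ‖(‖p‖ ^ 2)⁻¹ • invertedOscillatorField C α β p‖ ≤
      2 * ‖p‖ ^ (2 * (k + 2) - 1) + 4 * C * ‖p‖ ^ (k + 2) := by
    rw [norm_smul, Real.norm_of_nonneg (by positivity), inv_mul_le_iff₀ (by positivity)]
    refine hF.trans_eq ?_
    rw [show 2 * (k + 2) - 1 = 2 * k + 3 by omega]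
    ring
  have e2 : ‖(-(2 * C * (p 0 ^ (β + 1) * p 1 ^ α) * ‖p‖ ^ 2) / (‖p‖ ^ 2) ^ 2) • p‖ ≤
      2 * C * ‖p‖ ^ (k + 2) := by
    rw [norm_smul, Real.norm_eq_abs, abs_div, abs_neg, abs_mul, abs_mul,
      abs_of_pos (by positivity : 0 < 2 * C), abs_of_pos (by positivity : 0 < ‖p‖ ^ 2),
      abs_of_pos (by positivity : 0 < (‖p‖ ^ 2) ^ 2), div_mul_eq_mul_div,
      div_le_iff₀ (by positivity)]
    calc 2 * C * |p 0 ^ (β + 1) * p 1 ^ α| * ‖p‖ ^ 2 * ‖p‖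
        ≤ 2 * C * ‖p‖ ^ (k + 2 + 1) * ‖p‖ ^ 2 * ‖p‖ := by gcongr
      _ = _ := by ring
  calc _ ≤ _ := norm_add_le _ _
    _ ≤ _ := add_le_add e1 e2
    _ = _ := by ring

/-- The correction factor in the function comparing arc length of the inverted solution with its
distance to the origin. -/
noncomputable def arcLengthWeight (C : ℝ) (n : ℕ) : ℝ := C / (2 * 4 ^ (n + 1))

theorem arcLengthWeight_pos (hC : 0 < C) (n : ℕ) : 0 < arcLengthWeight C n := by
  unfold arcLengthWeight; positivity

/-- Away from the axes s² ≤ 4|xy|; raise this to the power n + 1 and split |xy|^(n+1) into the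
radial factor and its mirror monomial, which is at most s^(n+1). -/
theorem radial_factor_ge (hα : Even α) (hβ : Odd β) {x y s : ℝ} (hs : 0 < s)
    (hxy : s ^ 2 = x ^ 2 + y ^ 2) (h : s ^ 4 ≤ 16 * (x * y) ^ 2) :
    s ^ (α + β + 1) ≤ 4 ^ (α + β + 1) * (x ^ (β + 1) * y ^ α) := by
  have hx : |x| ≤ s := abs_le_of_sq_le_sq (by nlinarith [sq_nonneg y]) hs.le
  have hy : |y| ≤ s := abs_le_of_sq_le_sq (by nlinarith [sq_nonneg x]) hs.le
  have h1 : s ^ 2 ≤ 4 * |x * y| := by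
    refine abs_le_of_sq_le_sq' ?_ (by positivity) |>.2
    rw [mul_pow, sq_abs]; nlinarith
  have h2 : |x * y| ^ (α + β + 1) ≤ (x ^ (β + 1) * y ^ α) * s ^ (α + β + 1) := by
    calc |x * y| ^ (α + β + 1) = |x ^ (β + 1) * y ^ α| * |x ^ α * y ^ (β + 1)| := by
          simp only [abs_mul, abs_pow]; ring
      _ ≤ (x ^ (β + 1) * y ^ α) * s ^ (α + β + 1) := by
          rw [abs_of_nonneg (radial_factor_nonneg hα hβ x y)]
          exact mul_le_mul_of_nonneg_left (abs_pow_mul_pow_le hx hy α (β + 1))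
            (radial_factor_nonneg hα hβ x y)
  have h3 : (s ^ 2) ^ (α + β + 1) ≤ (4 * |x * y|) ^ (α + β + 1) := by gcongr
  rw [mul_pow] at h3
  refine le_of_mul_le_mul_right ?_ (pow_pos hs (α + β + 1))
  calc s ^ (α + β + 1) * s ^ (α + β + 1) = (s ^ 2) ^ (α + β + 1) := by ring
    _ ≤ _ := h3
    _ ≤ _ := mul_le_mul_of_nonneg_left h2 (by positivity)
    _ = _ := by ring

/-- This is the derivative bound for the gauge, multiplied by s⁵. Away from the axes the radial term
contributes 2κ s^(2k+8) and the quartic loses at most half of it; near the axes the quartic itself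
gives κ/2. The remainder costs κ/4, which is what 24C ≤ s is for. -/
theorem arcLength_deriv_ge (hC : 0 < C) (hα : Even α) (hβ : Odd β) {k : ℕ}
    (hn : α + β = k + 2) {x y s : ℝ} (hs1 : 1 ≤ s) (hsC : 24 * C ≤ s)
    (hxy : s ^ 2 = x ^ 2 + y ^ 2) :
    arcLengthWeight C (k + 2) / 4 * s ^ (2 * k + 8) ≤
      C * (x ^ (β + 1) * y ^ α) * s ^ (k + 5) + arcLengthWeight C (k + 2) *
        ((s ^ 2) ^ (k + 2) * ((s ^ 2) ^ 2 - 8 * (x * y) ^ 2)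
          + C * (x ^ β * y ^ (α + 1)) * (y ^ 4 - 5 * x ^ 2 * y ^ 2)) := by
  have hs : 0 < s := by linarith
  have hκ := arcLengthWeight_pos hC (k + 2)
  set κ := arcLengthWeight C (k + 2) with hκd
  have hP0 := radial_factor_nonneg hα hβ x y
  have hx : |x| ≤ s := abs_le_of_sq_le_sq (by nlinarith [sq_nonneg y]) hs.le
  have hy : |y| ≤ s := abs_le_of_sq_le_sq (by nlinarith [sq_nonneg x]) hs.le
  have hxy4 : (s ^ 2) ^ 2 = (x ^ 2 - y ^ 2) ^ 2 + 4 * (x * y) ^ 2 := by rw [hxy]; ring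
  have herr : |C * (x ^ β * y ^ (α + 1)) * (y ^ 4 - 5 * x ^ 2 * y ^ 2)| ≤
      s ^ (2 * k + 8) / 4 := by
    have e1 : |x ^ β * y ^ (α + 1)| ≤ s ^ (k + 3) := by
      have := abs_pow_mul_pow_le hx hy β (α + 1)
      rwa [show β + (α + 1) = k + 3 by omega] at this
    have e2 : |y ^ 4 - 5 * x ^ 2 * y ^ 2| ≤ 6 * s ^ 4 := by
      have a1 : y ^ 2 ≤ s ^ 2 := by nlinarith [sq_nonneg x]
      have a2 : x ^ 2 ≤ s ^ 2 := by nlinarith [sq_nonneg y]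
      have a3 := mul_le_mul a1 a1 (sq_nonneg y) (sq_nonneg s)
      have a4 := mul_le_mul a2 a1 (sq_nonneg y) (sq_nonneg s)
      have a5 := mul_nonneg (sq_nonneg x) (sq_nonneg y)
      have a6 := mul_nonneg (sq_nonneg y) (sq_nonneg y)
      rw [abs_le]; constructor <;> nlinarith
    rw [abs_mul, abs_mul, abs_of_pos hC]
    have h1 : s * s ^ (k + 7) ≤ s ^ k * s ^ (k + 7) * s := by
      have : 1 ≤ s ^ k := one_le_pow₀ hs1
      have h7 : 0 < s ^ (k + 7) * s := by positivity
      nlinarith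
    calc C * |x ^ β * y ^ (α + 1)| * |y ^ 4 - 5 * x ^ 2 * y ^ 2|
        ≤ C * s ^ (k + 3) * (6 * s ^ 4) := by gcongr
      _ = 24 * C * s ^ (k + 7) / 4 := by ring
      _ ≤ s * s ^ (k + 7) / 4 := by gcongr
      _ ≤ s ^ k * s ^ (k + 7) * s / 4 := by linarith
      _ = s ^ (2 * k + 8) / 4 := by ring
  have herr' := mul_le_mul_of_nonneg_left (abs_le.1 herr).1 hκ.le
  have hD : (s ^ 2) ^ (k + 2) * (s ^ 2) ^ 2 = s ^ (2 * k + 8) := by ring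
  have hD0 : 0 < s ^ (2 * k + 8) := by positivity
  have hA0 : 0 < (s ^ 2) ^ (k + 2) := by positivity
  suffices h : κ / 2 * s ^ (2 * k + 8) ≤ C * (x ^ (β + 1) * y ^ α) * s ^ (k + 5)
      + κ * ((s ^ 2) ^ (k + 2) * ((s ^ 2) ^ 2 - 8 * (x * y) ^ 2)) by
    linarith
  rcases le_total (s ^ 4) (16 * (x * y) ^ 2) with h | h
  · have hP := radial_factor_ge hα hβ hs hxy h
    rw [hn] at hP
    have h1 : 2 * κ * s ^ (2 * k + 8) ≤ C * (x ^ (β + 1) * y ^ α) * s ^ (k + 5) := by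
      have h4 : 2 * κ * 4 ^ (k + 2 + 1) = C := by
        rw [hκd, arcLengthWeight]; field_simp
      calc 2 * κ * s ^ (2 * k + 8) = 2 * κ * s ^ (k + 5) * s ^ (k + 2 + 1) := by ring
        _ ≤ 2 * κ * s ^ (k + 5) * (4 ^ (k + 2 + 1) * (x ^ (β + 1) * y ^ α)) := by gcongr
        _ = 2 * κ * 4 ^ (k + 2 + 1) * (x ^ (β + 1) * y ^ α) * s ^ (k + 5) := by ring
        _ = _ := by rw [h4]
    have h2 : -(s ^ (2 * k + 8)) ≤ (s ^ 2) ^ (k + 2) * ((s ^ 2) ^ 2 - 8 * (x * y) ^ 2) := by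
      rw [← hD]; nlinarith [sq_nonneg (x ^ 2 - y ^ 2)]
    have h3 := mul_le_mul_of_nonneg_left h2 hκ.le
    nlinarith
  · have h2 : s ^ (2 * k + 8) / 2 ≤ (s ^ 2) ^ (k + 2) * ((s ^ 2) ^ 2 - 8 * (x * y) ^ 2) := by
      rw [← hD]; nlinarith
    have h3 := mul_le_mul_of_nonneg_left h2 hκ.le
    have h4 : 0 ≤ C * (x ^ (β + 1) * y ^ α) * s ^ (k + 5) := by positivity
    linarith

/-- A function along solutions which is comparable with `‖γ‖ ^ (α + β - 2)` and whose derivative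
dominates the speed of the inverted solution. -/
noncomputable def arcLengthGauge (C : ℝ) (n : ℕ) (p : EuclideanSpace ℝ (Fin 2)) : ℝ :=
  ‖p‖ ^ (n - 2) + arcLengthWeight C n * (p 0 * p 1 * (p 0 ^ 2 - p 1 ^ 2) / ‖p‖ ^ 5)

theorem abs_arcLengthGauge_sub_le (hC : 0 < C) (n : ℕ) {p : EuclideanSpace ℝ (Fin 2)}
    (hp : 1 ≤ ‖p‖) : |arcLengthGauge C n p - ‖p‖ ^ (n - 2)| ≤ arcLengthWeight C n := by
  have hκ := arcLengthWeight_pos hC n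
  rw [arcLengthGauge, add_sub_cancel_left, abs_mul, abs_of_pos hκ]
  refine mul_le_of_le_one_right hκ.le ?_
  rw [abs_div, abs_of_pos (by positivity : 0 < ‖p‖ ^ 5), div_le_one (by positivity)]
  have hm := abs_pow_mul_pow_le (EuclideanSpace.abs_apply_le_norm p 0)
    (EuclideanSpace.abs_apply_le_norm p 1) 1 1
  have hm3 : |p 0 ^ 2 - p 1 ^ 2| ≤ ‖p‖ ^ 2 := by
    rw [EuclideanSpace.norm_sq_fin_two, abs_le]
    constructor <;> nlinarith [sq_nonneg (p 0), sq_nonneg (p 1)]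
  rw [pow_one, pow_one] at hm
  rw [abs_mul]
  calc _ ≤ ‖p‖ ^ (1 + 1) * ‖p‖ ^ 2 := by gcongr
    _ = ‖p‖ ^ 4 := by ring
    _ ≤ ‖p‖ ^ 5 := pow_le_pow_right₀ hp (by norm_num)

theorem hasDerivWithinAt_arcLengthGauge (hC : 0 < C) (hα : Even α) (hβ : Odd β) (hαβ : 1 < α + β)
    (h : IsIntegralCurveOn γ (fun _ => invertedOscillatorField C α β) I) {t : ℝ} (ht : t ∈ I)
    (h1 : 1 ≤ ‖γ t‖) (h2 : 24 * C ≤ ‖γ t‖) :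
    ∃ g', HasDerivWithinAt (fun t => arcLengthGauge C (α + β) (γ t)) g' I t ∧
      arcLengthWeight C (α + β) / 4 * ‖γ t‖ ^ (2 * (α + β) - 1) ≤ g' := by
  have hn : 0 < ‖γ t‖ := by linarith
  have h0 : γ t ≠ 0 := norm_pos_iff.1 hn
  have hs := hasDerivWithinAt_norm h ht h0
  have hq := hasDerivWithinAt_quartic h ht
  have hodd : Odd (α + β) := hα.add_odd hβ
  -- Oddness excludes n = 2, for which r^(n-2) would be constant and provide no radial growth.
  obtain ⟨k, hk, hk1⟩ : ∃ k, α + β = k + 2 ∧ 1 ≤ k := by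
    obtain ⟨j, hj⟩ := hodd
    exact ⟨α + β - 2, by omega, by omega⟩
  refine ⟨_, (hs.pow (α + β - 2)).add ((hq.div (hs.pow 5) (pow_pos hn 5).ne').const_mul
    (arcLengthWeight C (α + β))), ?_⟩
  have key := arcLength_deriv_ge hC hα hβ hk h1 h2 (EuclideanSpace.norm_sq_fin_two (γ t))
  rw [hk]
  rw [show 2 * (k + 2) - 1 = 2 * k + 3 by omega, show k + 2 - 2 = k by omega]
  refine le_of_mul_le_mul_right ?_ (pow_pos hn 5)
  have hP0 := radial_factor_nonneg hα hβ (γ t 0) (γ t 1)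
  have hk' : (1 : ℝ) ≤ k := by exact_mod_cast hk1
  set κ := arcLengthWeight C (k + 2)
  set x := γ t 0
  set y := γ t 1
  set s := ‖γ t‖
  have hpk : s ^ (k - 1) * s = s ^ k := by rw [← pow_succ]; congr 1; omega
  calc κ / 4 * s ^ (2 * k + 3) * s ^ 5 = κ / 4 * s ^ (2 * k + 8) := by ring
    _ ≤ _ := key
    _ ≤ k * (C * (x ^ (β + 1) * y ^ α) * s ^ (k + 5)) + κ *
        ((s ^ 2) ^ (k + 2) * ((s ^ 2) ^ 2 - 8 * (x * y) ^ 2)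
          + C * (x ^ β * y ^ (α + 1)) * (y ^ 4 - 5 * x ^ 2 * y ^ 2)) := by
        have := le_mul_of_one_le_left
          (by positivity : 0 ≤ C * (x ^ (β + 1) * y ^ α) * s ^ (k + 5)) hk'
        linarith
    _ = (k * (s ^ (k - 1) * s) * (C * (x ^ (β + 1) * y ^ α))) * s ^ 5 + κ *
        ((s ^ 2) ^ (k + 2) * ((s ^ 2) ^ 2 - 8 * (x * y) ^ 2)
          + C * (x ^ β * y ^ (α + 1)) * (y ^ 4 - 5 * x ^ 2 * y ^ 2)) := by
        rw [hpk]; ring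
    _ = _ := by
        simp only [Pi.pow_apply]
        field_simp
        push_cast
        ring

/-- Along a solution far from the origin, the inverted solution moves by at most the increment of a
multiple of the gauge. -/
theorem dist_geomInversion_le (hC : 0 < C) (hα : Even α) (hβ : Odd β) (hαβ : 1 < α + β)
    (h : IsIntegralCurveOn γ (fun _ => invertedOscillatorField C α β) I) {a b : ℝ}
    (hI : Icc a b ⊆ I) (hab : a ≤ b) (h1 : 1 ≤ ‖γ a‖) (h2 : 24 * C ≤ ‖γ a‖) :
    dist (geomInversion (γ a)) (geomInversion (γ b)) ≤
      4 * (2 + 6 * C) / arcLengthWeight C (α + β) * arcLengthGauge C (α + β) (γ b)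
        - 4 * (2 + 6 * C) / arcLengthWeight C (α + β) * arcLengthGauge C (α + β) (γ a) := by
  have hκ := arcLengthWeight_pos hC (α + β)
  have hmono : ∀ t ∈ Icc a b, ‖γ a‖ ≤ ‖γ t‖ := fun t ht =>
    norm_le_norm_of_le hC hα hβ h ((Icc_subset_Icc_right ht.2).trans hI) ht.1
  have hg : ∀ t ∈ Icc a b, ∃ g', HasDerivWithinAt (fun t => arcLengthGauge C (α + β) (γ t)) g' I t ∧
      arcLengthWeight C (α + β) / 4 * ‖γ t‖ ^ (2 * (α + β) - 1) ≤ g' := fun t ht =>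
    hasDerivWithinAt_arcLengthGauge hC hα hβ hαβ h (hI ht) (h1.trans (hmono t ht))
      (h2.trans (hmono t ht))
  choose! g' hg' hgb using hg
  rw [dist_comm, dist_eq_norm]
  have hne : ∀ t ∈ Icc a b, γ t ≠ 0 := fun t ht =>
    norm_pos_iff.1 (by linarith [hmono t ht])
  refine norm_sub_le_sub_of_hasDerivWithinAt hI
    (fun t ht => hasDerivWithinAt_geomInversion h (hI ht) (hne t ht))
    (fun t ht => (hg' t ht).const_mul _) (fun t ht => ?_) hab
  refine (norm_deriv_geomInversion_le hC hαβ (hne t ht)).trans ?_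
  have hs1 : 1 ≤ ‖γ t‖ := h1.trans (hmono t ht)
  calc 2 * ‖γ t‖ ^ (2 * (α + β) - 1) + 6 * C * ‖γ t‖ ^ (α + β)
      ≤ 2 * ‖γ t‖ ^ (2 * (α + β) - 1) + 6 * C * ‖γ t‖ ^ (2 * (α + β) - 1) := by
        gcongr
        omega
    _ = 4 * (2 + 6 * C) / arcLengthWeight C (α + β) *
        (arcLengthWeight C (α + β) / 4 * ‖γ t‖ ^ (2 * (α + β) - 1)) := by field_simp
    _ ≤ _ := mul_le_mul_of_nonneg_left (hgb t ht) (by positivity)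

end Solution

/-! ### Polar angle and the spiral -/

section Angle

variable {C : ℝ} {α β : ℕ} {T : EReal} {γ : ℝ → EuclideanSpace ℝ (Fin 2)}

/-- The angular velocity of the inverted oscillator. -/
noncomputable def angularVelocity (C : ℝ) (α β : ℕ) (p : EuclideanSpace ℝ (Fin 2)) : ℝ :=
  (‖p‖ ^ 2) ^ (α + β) + C * (p 0 ^ β * p 1 ^ (α + 1))

theorem exists_hasDerivAt_of_continuousOn_Ico {q : ℝ → ℝ} {t₀ : ℝ} (θ₀ : ℝ)
    (ht₀ : t₀ ∈ forwardInterval T) (hq : ContinuousOn q (forwardInterval T ∩ Ici t₀)) :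
    ∃ θ : ℝ → ℝ, θ t₀ = θ₀ ∧ ∀ t ∈ forwardInterval T ∩ Ici t₀, HasDerivAt θ (q t) t := by
  set U : Set ℝ := {t | (t : EReal) < T} with hU
  have hUo : IsOpen U := isOpen_Iio.preimage continuous_coe_real_ereal
  -- Freezing `q` to the left of t₀ makes the integrand continuous on an open set, so the primitive
  -- has a two-sided derivative even at t₀.
  have hmaps : MapsTo (fun t => max t t₀) U (forwardInterval T ∩ Ici t₀) := fun t ht => by
    refine ⟨⟨ht₀.1.trans (le_max_right _ _), ?_⟩, le_max_right t t₀⟩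
    change ((max t t₀ : ℝ) : EReal) < T
    rcases max_choice t t₀ with h | h
    · rw [h]; exact ht
    · rw [h]; exact ht₀.2
  have hc : ContinuousOn (fun t => q (max t t₀)) U :=
    hq.comp (by fun_prop) hmaps
  refine ⟨fun t => θ₀ + ∫ s in t₀..t, q (max s t₀), by simp, fun t ht => ?_⟩
  have htU : t ∈ U := ht.1.2
  have hsub : uIcc t₀ t ⊆ U := by
    rw [uIcc_of_le ht.2]
    exact fun s hs => (EReal.coe_le_coe_iff.2 hs.2).trans_lt htU
  have := (intervalIntegral.integral_hasDerivAt_right (hc.mono hsub).intervalIntegrable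
    (hc.stronglyMeasurableAtFilter hUo t htU) (hc.continuousAt (hUo.mem_nhds htU))).const_add θ₀
  rwa [max_eq_left ht.2] at this

theorem exists_pos_polar_angle (p : EuclideanSpace ℝ (Fin 2)) :
    ∃ θ : ℝ, 0 < θ ∧ p 0 = ‖p‖ * Real.cos θ ∧ p 1 = ‖p‖ * Real.sin θ := by
  set z : ℂ := ⟨p 0, p 1⟩ with hz
  have hn : ‖z‖ = ‖p‖ := by
    rw [← sq_eq_sq₀ (norm_nonneg _) (norm_nonneg _), EuclideanSpace.norm_sq_fin_two,
      Complex.sq_norm, Complex.normSq_apply]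
    simp [hz, sq]
  refine ⟨z.arg + 2 * Real.pi, by linarith [Complex.neg_pi_lt_arg z, Real.pi_pos], ?_, ?_⟩
  · rw [Real.cos_add_two_pi, ← hn, Complex.norm_mul_cos_arg]
  · rw [Real.sin_add_two_pi, ← hn, Complex.norm_mul_sin_arg]

/-- A continuous choice of the polar angle along a solution. -/
theorem exists_angle (hC : 0 < C) (hα : Even α) (hβ : Odd β)
    (h : IsIntegralCurveOn γ (fun _ => invertedOscillatorField C α β) (forwardInterval T))
    {t₀ : ℝ} (ht₀ : t₀ ∈ forwardInterval T) (h0 : γ t₀ ≠ 0) :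
    ∃ θ : ℝ → ℝ, 0 < θ t₀ ∧ ∀ t ∈ forwardInterval T ∩ Ici t₀,
      HasDerivAt θ (angularVelocity C α β (γ t)) t ∧
      γ t 0 = ‖γ t‖ * Real.cos (θ t) ∧ γ t 1 = ‖γ t‖ * Real.sin (θ t) := by
  obtain ⟨θ₀, hθ₀, hx₀, hy₀⟩ := exists_pos_polar_angle (γ t₀)
  have hqc : ContinuousOn (fun t => angularVelocity C α β (γ t)) (forwardInterval T ∩ Ici t₀) := by
    have : Continuous (angularVelocity C α β) := by unfold angularVelocity; fun_prop
    exact this.comp_continuousOn (h.continuousOn.mono inter_subset_left)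
  obtain ⟨θ, hθ, hθ'⟩ := exists_hasDerivAt_of_continuousOn_Ico θ₀ ht₀ hqc
  refine ⟨θ, hθ ▸ hθ₀, fun t ht => ⟨hθ' t ht, ?_⟩⟩
  have hsub : Icc t₀ t ⊆ forwardInterval T := Icc_subset_forwardInterval ht₀.1 ht.1
  have hsub' : Icc t₀ t ⊆ forwardInterval T ∩ Ici t₀ := fun s hs => ⟨hsub hs, hs.1⟩
  have hne : ∀ s ∈ Icc t₀ t, γ s ≠ 0 := fun s hs =>
    ne_zero_of_le hC hα hβ h ((Icc_subset_Icc_right hs.2).trans hsub) hs.1 h0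
  have hconst : ∀ g : ℝ → ℝ, (∀ s ∈ Icc t₀ t, HasDerivWithinAt g 0 (forwardInterval T) s) →
      g t = g t₀ := fun g hg => by
    have := norm_sub_le_sub_of_hasDerivWithinAt (g := fun _ => (0 : ℝ)) (g' := fun _ => 0) hsub hg
      (fun s _ => hasDerivWithinAt_const _ _ _) (by simp) ht.2
    rw [sub_self, norm_le_zero_iff, sub_eq_zero] at this
    exact this
  -- `A` and `B` are the components of γ/|γ| in the frame rotated by θ. Both have zero derivative,
  -- so they keep their initial values 1 and 0.
  set A : ℝ → ℝ := fun s => (γ s 0 * Real.cos (θ s) + γ s 1 * Real.sin (θ s)) / ‖γ s‖ with hA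
  set B : ℝ → ℝ := fun s => (γ s 1 * Real.cos (θ s) - γ s 0 * Real.sin (θ s)) / ‖γ s‖ with hB
  have hn0 : ‖γ t₀‖ ≠ 0 := norm_ne_zero_iff.2 h0
  have hn : ‖γ t‖ ≠ 0 := norm_ne_zero_iff.2 (hne t (right_mem_Icc.2 ht.2))
  have hA1 : A t = 1 := by
    rw [hconst A fun s hs => ?_]
    · simp only [hA, hθ]
      rw [hx₀, hy₀, div_eq_one_iff_eq hn0]
      linear_combination ‖γ t₀‖ * Real.cos_sq_add_sin_sq θ₀
    · have hs0 : ‖γ s‖ ≠ 0 := norm_ne_zero_iff.2 (hne s hs)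
      have hθs := (hθ' s (hsub' hs)).hasDerivWithinAt (s := forwardInterval T)
      refine ((((hasDerivWithinAt_fst h (hsub hs)).mul hθs.cos).add
        ((hasDerivWithinAt_snd h (hsub hs)).mul hθs.sin)).div
        (hasDerivWithinAt_norm h (hsub hs) (hne s hs)) hs0).congr_deriv ?_
      rw [div_eq_zero_iff]
      left
      simp only [angularVelocity, ← EuclideanSpace.norm_sq_fin_two, Pi.add_apply, Pi.mul_apply]
      rw [EuclideanSpace.norm_sq_fin_two]
      ring
  have hB0 : B t = 0 := by
    rw [hconst B fun s hs => ?_]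
    · simp only [hB, hθ]
      rw [hx₀, hy₀]
      ring
    · have hs0 : ‖γ s‖ ≠ 0 := norm_ne_zero_iff.2 (hne s hs)
      have hθs := (hθ' s (hsub' hs)).hasDerivWithinAt (s := forwardInterval T)
      refine ((((hasDerivWithinAt_snd h (hsub hs)).mul hθs.cos).sub
        ((hasDerivWithinAt_fst h (hsub hs)).mul hθs.sin)).div
        (hasDerivWithinAt_norm h (hsub hs) (hne s hs)) hs0).congr_deriv ?_
      rw [div_eq_zero_iff]
      left
      simp only [angularVelocity, ← EuclideanSpace.norm_sq_fin_two, Pi.sub_apply, Pi.mul_apply]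
      rw [EuclideanSpace.norm_sq_fin_two]
      ring
  rw [hA, div_eq_one_iff_eq hn] at hA1
  rw [hB, div_eq_zero_iff, or_iff_left hn] at hB0
  have hcs := Real.cos_sq_add_sin_sq (θ t)
  constructor
  · linear_combination (-γ t 0) * hcs + Real.cos (θ t) * hA1 - Real.sin (θ t) * hB0
  · linear_combination (-γ t 1) * hcs + Real.sin (θ t) * hA1 + Real.cos (θ t) * hB0

/-- The damping terms have degree n + 1 and the rotation has degree 2n ≥ n + 2. This serves both the
lower bound on the angular velocity and the comparison of log r with θ. -/
theorem mul_pow_le_half_pow (hαβ : 1 < α + β) {s : ℝ} (h1 : 1 ≤ s) (h2 : 2 * C ≤ s) :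
    C * s ^ (α + β + 1) ≤ s ^ (2 * (α + β)) / 2 := by
  have h3 : 2 * C * s ^ (α + β + 1) ≤ s ^ (α + β + 2) := by
    rw [pow_succ s (α + β + 1), mul_comm (s ^ (α + β + 1)) s]
    gcongr
  have h4 : s ^ (α + β + 2) ≤ s ^ (2 * (α + β)) := pow_le_pow_right₀ h1 (by omega)
  linarith

theorem angularVelocity_ge (hC : 0 < C) (hαβ : 1 < α + β) {p : EuclideanSpace ℝ (Fin 2)}
    (h1 : 1 ≤ ‖p‖) (h2 : 2 * C ≤ ‖p‖) :
    ‖p‖ ^ (2 * (α + β)) / 2 ≤ angularVelocity C α β p := by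
  have hm := abs_pow_mul_pow_le (EuclideanSpace.abs_apply_le_norm p 0)
    (EuclideanSpace.abs_apply_le_norm p 1) β (α + 1)
  rw [show β + (α + 1) = α + β + 1 by ring] at hm
  have h3 := mul_pow_le_half_pow (C := C) hαβ h1 h2
  have h4 := mul_le_mul_of_nonneg_left (abs_le.1 hm).1 hC.le
  rw [angularVelocity, ← pow_mul]
  linarith

/-- Polar coordinates along a solution far from the origin: the angle increases to infinity. -/
structure IsPolarAngle (C : ℝ) (α β : ℕ) (γ : ℝ → EuclideanSpace ℝ (Fin 2)) (J : Set ℝ) (t₀ : ℝ)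
    (θ : ℝ → ℝ) : Prop where
  pos : 0 < θ t₀
  hasDerivAt : ∀ t ∈ J, HasDerivAt θ (angularVelocity C α β (γ t)) t
  fst_eq : ∀ t ∈ J, γ t 0 = ‖γ t‖ * Real.cos (θ t)
  snd_eq : ∀ t ∈ J, γ t 1 = ‖γ t‖ * Real.sin (θ t)
  strictMonoOn : StrictMonoOn θ J
  image_eq : θ '' J = Ici (θ t₀)

theorem exists_isPolarAngle (hC : 0 < C) (hα : Even α) (hβ : Odd β) (hαβ : 1 < α + β)
    (hγ : IsMaximalForwardSolution (invertedOscillatorField C α β) T γ) (hγ0 : γ 0 ≠ 0)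
    {t₀ : ℝ} (ht₀ : t₀ ∈ forwardInterval T) (h1 : 1 ≤ ‖γ t₀‖) (h2 : 2 * C ≤ ‖γ t₀‖) :
    ∃ θ, IsPolarAngle C α β γ (forwardInterval T ∩ Ici t₀) t₀ θ := by
  have h := hγ.solution
  have h0 : γ t₀ ≠ 0 := norm_pos_iff.1 (by linarith)
  obtain ⟨θ, hpos, hθ⟩ := exists_angle hC hα hβ h ht₀ h0
  set J := forwardInterval T ∩ Ici t₀ with hJ
  have hsub : ∀ {a b}, a ∈ J → b ∈ J → Icc a b ⊆ J := fun ha hb s hs =>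
    ⟨Icc_subset_forwardInterval ha.1.1 hb.1 hs, ha.2.trans hs.1⟩
  have ht₀J : t₀ ∈ J := ⟨ht₀, self_mem_Ici⟩
  have hmono : ∀ t ∈ J, ‖γ t₀‖ ≤ ‖γ t‖ := fun t ht =>
    norm_le_norm_of_le hC hα hβ h (Icc_subset_forwardInterval ht₀.1 ht.1) ht.2
  have hge : ∀ t ∈ J, ‖γ t‖ ^ (2 * (α + β)) / 2 ≤ angularVelocity C α β (γ t) := fun t ht =>
    angularVelocity_ge hC hαβ (h1.trans (hmono t ht)) (h2.trans (hmono t ht))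
  have hstrict : StrictMonoOn θ J := fun a ha b hb hab => by
    have := norm_sub_le_sub_of_hasDerivWithinAt (w := fun t : ℝ => t / 2) (w' := fun _ => 1 / 2)
      (hsub ha hb) (fun t _ => ((hasDerivAt_id t).div_const 2).hasDerivWithinAt)
      (fun t ht => (hθ t (hsub ha hb ht)).1.hasDerivWithinAt)
      (fun t ht => by
        have htJ := hsub ha hb ht
        refine le_trans ?_ (hge t htJ)
        rw [Real.norm_of_nonneg (by norm_num)]
        gcongr
        exact one_le_pow₀ (h1.trans (hmono t htJ))) hab.le
    have h3 := (le_abs_self _).trans this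
    linarith
  have hcont : ContinuousOn θ J := fun t ht => (hθ t ht).1.continuousAt.continuousWithinAt
  -- Since r'/r ≤ C r^(n+1) ≤ r^(2n)/2 ≤ θ', unboundedness of r forces θ to take every value above
  -- its initial one.
  have hlog : ∀ t ∈ J, Real.log ‖γ t‖ - Real.log ‖γ t₀‖ ≤ θ t - θ t₀ := fun t ht => by
    have hs := hsub ht₀J ht
    refine (le_abs_self _).trans (norm_sub_le_sub_of_hasDerivWithinAt
      (w := fun t => Real.log ‖γ t‖) (hs.trans inter_subset_left)
      (fun u hu => (hasDerivWithinAt_norm h (hs hu).1 (norm_pos_iff.1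
        (by linarith [hmono u (hs hu)]))).log (by linarith [hmono u (hs hu)]))
      (fun u hu => (hθ u (hs hu)).1.hasDerivWithinAt) (fun u hu => ?_) ht.2)
    have hu0 := hmono u (hs hu)
    have hup : 0 < ‖γ u‖ := by linarith
    have hm := abs_pow_mul_pow_le (EuclideanSpace.abs_apply_le_norm (γ u) 0)
      (EuclideanSpace.abs_apply_le_norm (γ u) 1) (β + 1) α
    rw [show β + 1 + α = α + β + 1 by ring] at hm
    rw [mul_div_cancel_right₀ _ hup.ne', norm_mul, Real.norm_of_nonneg hC.le]
    exact (mul_le_mul_of_nonneg_left hm hC.le).trans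
      ((mul_pow_le_half_pow hαβ (h1.trans hu0) (h2.trans hu0)).trans (hge u (hs hu)))
  refine ⟨θ, hpos, fun t ht => (hθ t ht).1, fun t ht => (hθ t ht).2.1,
    fun t ht => (hθ t ht).2.2, hstrict, Subset.antisymm ?_ fun φ hφ => ?_⟩
  · rintro _ ⟨t, ht, rfl⟩
    exact hstrict.monotoneOn ht₀J ht ht.2
  · obtain ⟨t, ht, hR⟩ := hγ.norm_unbounded hC hα hβ hγ0 (‖γ t₀‖ * Real.exp (φ - θ t₀))
    have hn0 : 0 < ‖γ t₀‖ := by linarith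
    have hφ' : θ t₀ ≤ φ := hφ
    have htt : t₀ ≤ t := by
      by_contra! hlt
      have h3 := norm_le_norm_of_le hC hα hβ h (Icc_subset_forwardInterval ht.1 ht₀) hlt.le
      have h4 := le_mul_of_one_le_right hn0.le (Real.one_le_exp (sub_nonneg.2 hφ'))
      linarith
    have htJ : t ∈ J := ⟨ht, htt⟩
    have h5 := Real.log_lt_log (by positivity) hR
    rw [Real.log_mul hn0.ne' (Real.exp_pos _).ne', Real.log_exp] at h5
    have h6 := hlog t htJ
    obtain ⟨u, hu, hu'⟩ := intermediate_value_Icc htt (hcont.mono (hsub ht₀J htJ))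
      ⟨hφ', (by linarith : φ ≤ θ t)⟩
    exact ⟨u, hsub ht₀J htJ hu, hu'⟩

theorem IsPolarAngle.isPolarSpiralToInfinity (hC : 0 < C) (hα : Even α) (hβ : Odd β)
    (hγ : IsMaximalForwardSolution (invertedOscillatorField C α β) T γ) (hγ0 : γ 0 ≠ 0)
    {t₀ : ℝ} (ht₀ : t₀ ∈ forwardInterval T) (h0 : γ t₀ ≠ 0) {θ : ℝ → ℝ}
    (hθ : IsPolarAngle C α β γ (forwardInterval T ∩ Ici t₀) t₀ θ) :
    IsPolarSpiralToInfinity (γ '' (forwardInterval T ∩ Ici t₀)) := by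
  have h := hγ.solution
  set J := forwardInterval T ∩ Ici t₀ with hJ
  have hJo : J.OrdConnected := (ordConnected_forwardInterval T).inter ordConnected_Ici
  have himo : (θ '' J).OrdConnected := hθ.image_eq ▸ ordConnected_Ici
  set e := hθ.strictMonoOn.orderIso θ J
  set τ := Function.invFunOn θ J with hτ
  have hτJ : ∀ φ ∈ Ici (θ t₀), τ φ ∈ J := fun φ hφ =>
    Function.invFunOn_mem (by rw [← hθ.image_eq] at hφ; exact hφ)
  have hθτ : ∀ φ ∈ Ici (θ t₀), θ (τ φ) = φ := fun φ hφ =>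
    Function.invFunOn_eq (by rw [← hθ.image_eq] at hφ; exact hφ)
  have hτθ : ∀ t ∈ J, τ (θ t) = t := fun t ht =>
    hθ.strictMonoOn.injOn.leftInvOn_invFunOn ht
  have hθge : ∀ t ∈ J, θ t ∈ Ici (θ t₀) := fun t ht => hθ.image_eq ▸ mem_image_of_mem θ ht
  have hτmono : ∀ φ ∈ Ici (θ t₀), ∀ ψ ∈ Ici (θ t₀), φ < ψ → τ φ < τ ψ := fun φ hφ ψ hψ hlt => by
    rw [← hθ.strictMonoOn.lt_iff_lt (hτJ φ hφ) (hτJ ψ hψ), hθτ φ hφ, hθτ ψ hψ]; exact hlt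
  -- The inverse of θ is an order isomorphism between order-connected sets, hence continuous.
  have hτc : ContinuousOn τ (Ici (θ t₀)) := by
    rw [← hθ.image_eq, continuousOn_iff_continuous_domRestrict]
    have : (θ '' J).domRestrict τ = fun x => ((e.symm x : J) : ℝ) := by
      funext x
      obtain ⟨y, rfl⟩ := e.surjective x
      rw [OrderIso.symm_apply_apply]
      exact hτθ y y.2
    rw [this]
    exact continuous_subtype_val.comp e.symm.continuous
  have hlt : ∀ a ∈ J, ∀ b ∈ J, a < b → ‖γ a‖ < ‖γ b‖ := fun a ha b hb hab =>
    norm_lt_norm_of_lt hC hα hβ h (Icc_subset_forwardInterval ha.1.1 hb.1) hab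
      (ne_zero_of_le hC hα hβ h (Icc_subset_forwardInterval ht₀.1 ha.1) ha.2 h0)
  refine ⟨1, θ t₀, fun φ => ‖γ (τ φ)‖, .inl rfl, hθ.pos, ?_, ?_, ?_, ?_, ?_⟩
  · exact (h.continuousOn.comp hτc fun φ hφ => (hτJ φ hφ).1).norm
  · exact fun φ hφ => norm_pos_iff.2 (ne_zero_of_le hC hα hβ h
      (Icc_subset_forwardInterval ht₀.1 (hτJ φ hφ).1) (hτJ φ hφ).2 h0)
  · refine tendsto_atTop.2 fun R => ?_
    obtain ⟨t, ht, hR⟩ := hγ.norm_unbounded hC hα hβ hγ0 (max R ‖γ t₀‖)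
    have htt : t₀ < t := by
      by_contra! hle
      have h3 := norm_le_norm_of_le hC hα hβ h (Icc_subset_forwardInterval ht.1 ht₀) hle
      linarith [le_max_right R ‖γ t₀‖]
    have htJ : t ∈ J := ⟨ht, htt.le⟩
    filter_upwards [eventually_gt_atTop (θ t)] with φ hφ
    have hφ' : φ ∈ Ici (θ t₀) := (hθge t htJ).trans hφ.le
    have h3 := hτmono _ (hθge t htJ) φ hφ' hφ
    rw [hτθ t htJ] at h3
    linarith [hlt t htJ _ (hτJ φ hφ') h3, le_max_left R ‖γ t₀‖]
  · intro φ hφ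
    have hpi := Real.pi_pos
    have hφ' : φ + 2 * Real.pi ∈ Ici (θ t₀) := by
      rw [mem_Ici] at hφ ⊢; linarith
    exact hlt _ (hτJ φ hφ) _ (hτJ _ hφ') (hτmono φ hφ _ hφ' (by linarith))
  · have hpt : ∀ t ∈ J, γ t = !₂[‖γ t‖ * Real.cos (θ t), 1 * (‖γ t‖ * Real.sin (θ t))] :=
      fun t ht => by
        ext i
        fin_cases i
        · simpa using hθ.fst_eq t ht
        · simpa using hθ.snd_eq t ht
    ext p
    constructor
    · rintro ⟨t, ht, rfl⟩
      refine ⟨θ t, hθge t ht, ?_⟩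
      simp only [hτθ t ht]
      exact (hpt t ht).symm
    · rintro ⟨φ, hφ, rfl⟩
      refine ⟨τ φ, hτJ φ hφ, ?_⟩
      rw [hpt _ (hτJ φ hφ), hθτ φ hφ]

end Angle

/-! ### Area of neighbourhoods of the inverted trajectory -/

section Volume

variable {C : ℝ} {α β : ℕ} {T : EReal} {γ : ℝ → EuclideanSpace ℝ (Fin 2)}

theorem norm_geomInversion {n : ℕ} (x : EuclideanSpace ℝ (Fin n)) :
    ‖geomInversion x‖ = ‖x‖⁻¹ := by
  rcases eq_or_ne x 0 with rfl | hx
  · simp [geomInversion]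
  · have : 0 < ‖x‖ := norm_pos_iff.2 hx
    rw [geomInversion, norm_smul, Real.norm_of_nonneg (by positivity)]
    field_simp

/-- During one revolution the distance to the origin of the inverted solution drops by at most
a multiple of its `(α + β)`-th power. -/
theorem IsPolarAngle.inv_norm_ge (hC : 0 < C) (hα : Even α) (hβ : Odd β) (hαβ : 1 < α + β)
    (h : IsIntegralCurveOn γ (fun _ => invertedOscillatorField C α β) (forwardInterval T))
    {t₀ : ℝ} (ht₀ : t₀ ∈ forwardInterval T) (h1 : 1 ≤ ‖γ t₀‖) (h2 : 2 * C ≤ ‖γ t₀‖) {θ : ℝ → ℝ}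
    (hθ : IsPolarAngle C α β γ (forwardInterval T ∩ Ici t₀) t₀ θ) {a b : ℝ} (ha : t₀ ≤ a)
    (hab : a ≤ b) (hb : b ∈ forwardInterval T) :
    ‖γ a‖⁻¹ - 2 * C * (‖γ a‖⁻¹) ^ (α + β) * (θ b - θ a) ≤ ‖γ b‖⁻¹ := by
  have hsub : Icc a b ⊆ forwardInterval T := Icc_subset_forwardInterval (ht₀.1.trans ha) hb
  have hsub0 : Icc t₀ b ⊆ forwardInterval T := Icc_subset_forwardInterval ht₀.1 hb
  have hmono0 : ∀ t ∈ Icc a b, ‖γ t₀‖ ≤ ‖γ t‖ := fun t ht =>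
    norm_le_norm_of_le hC hα hβ h ((Icc_subset_Icc_right ht.2).trans hsub0) (ha.trans ht.1)
  have hmono : ∀ t ∈ Icc a b, ‖γ a‖ ≤ ‖γ t‖ := fun t ht =>
    norm_le_norm_of_le hC hα hβ h ((Icc_subset_Icc_right ht.2).trans hsub) ht.1
  have hpos : ∀ t ∈ Icc a b, 0 < ‖γ t‖ := fun t ht => by linarith [hmono0 t ht]
  have hpa := hpos a (left_mem_Icc.2 hab)
  -- The inverse norm decreases at rate at most C r^n, while θ' ≥ r^(2n)/2 and r ≥ |γ a|; the added
  -- multiple of θ therefore makes the sum nondecreasing.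
  have := le_of_hasDerivWithinAt_nonneg
    (g := fun t => ‖γ t‖⁻¹ + 2 * C * (‖γ a‖⁻¹) ^ (α + β) * θ t) hsub
    (fun t ht => ((hasDerivWithinAt_norm h (hsub ht) (norm_pos_iff.1 (hpos t ht))).inv
      (hpos t ht).ne').add (((hθ.hasDerivAt t ⟨hsub ht, ha.trans ht.1⟩).hasDerivWithinAt).const_mul
        (2 * C * (‖γ a‖⁻¹) ^ (α + β)))) (fun t ht => ?_) hab
  · linarith
  · have hs := hpos t ht
    have hq := angularVelocity_ge (α := α) (β := β) hC hαβ (h1.trans (hmono0 t ht))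
      (h2.trans (hmono0 t ht))
    have hm := (le_abs_self _).trans (abs_pow_mul_pow_le
      (EuclideanSpace.abs_apply_le_norm (γ t) 0) (EuclideanSpace.abs_apply_le_norm (γ t) 1) (β + 1) α)
    rw [show β + 1 + α = α + β + 1 by ring] at hm
    have e1 : C * (γ t 0 ^ (β + 1) * γ t 1 ^ α) * ‖γ t‖ / ‖γ t‖ ^ 2 ≤ C * ‖γ t‖ ^ (α + β) := by
      rw [div_le_iff₀ (by positivity)]
      calc _ ≤ C * ‖γ t‖ ^ (α + β + 1) * ‖γ t‖ := by gcongr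
        _ = _ := by ring
    have e2 : 1 ≤ (‖γ a‖⁻¹) ^ (α + β) * ‖γ t‖ ^ (α + β) := by
      rw [← mul_pow]
      refine one_le_pow₀ ?_
      rw [inv_mul_eq_div, one_le_div hpa]
      exact hmono t ht
    have e3 : C * ‖γ t‖ ^ (α + β) ≤
        2 * C * (‖γ a‖⁻¹) ^ (α + β) * angularVelocity C α β (γ t) := by
      calc C * ‖γ t‖ ^ (α + β) ≤ C * ‖γ t‖ ^ (α + β) * ((‖γ a‖⁻¹) ^ (α + β) * ‖γ t‖ ^ (α + β)) :=
            le_mul_of_one_le_right (by positivity) e2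
        _ = 2 * C * (‖γ a‖⁻¹) ^ (α + β) * (‖γ t‖ ^ (2 * (α + β)) / 2) := by
            rw [mul_comm 2 (α + β), pow_mul]; ring
        _ ≤ _ := by gcongr
    rw [neg_div]
    linarith

/-- Given p ≠ 0, let a be a time when the inverted solution has radius |p|, and let b be the next
time, within one turn, when it lies on the ray of p. The distance is then the radial drop between a
and b. The origin is a limit of the inverted trajectory. -/
theorem IsPolarAngle.ball_subset_thickening (hC : 0 < C) (hα : Even α) (hβ : Odd β)
    (hαβ : 1 < α + β)
    (hγ : IsMaximalForwardSolution (invertedOscillatorField C α β) T γ) (hγ0 : γ 0 ≠ 0)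
    {t₀ : ℝ} (ht₀ : t₀ ∈ forwardInterval T) (h1 : 1 ≤ ‖γ t₀‖) (h2 : 2 * C ≤ ‖γ t₀‖) {θ : ℝ → ℝ}
    (hθ : IsPolarAngle C α β γ (forwardInterval T ∩ Ici t₀) t₀ θ) {R ε : ℝ}
    (hR : R ≤ ‖γ t₀‖⁻¹) (hε : 0 < ε) (hRε : 4 * Real.pi * C * R ^ (α + β) < ε) :
    Metric.ball 0 R ⊆ Metric.thickening ε (geomInversion '' (γ '' forwardInterval T)) := by
  have h := hγ.solution
  intro p hp
  rw [mem_ball_zero_iff] at hp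
  rw [Metric.mem_thickening_iff]
  rcases eq_or_ne p 0 with rfl | hp0
  · obtain ⟨t, ht, htε⟩ := hγ.norm_unbounded hC hα hβ hγ0 ε⁻¹
    refine ⟨_, ⟨_, ⟨t, ht, rfl⟩, rfl⟩, ?_⟩
    rw [dist_zero_left, norm_geomInversion]
    exact inv_lt_of_inv_lt₀ hε htε
  set σ := ‖p‖ with hσ
  have hσ0 : 0 < σ := norm_pos_iff.2 hp0
  have hn0 : 0 < ‖γ t₀‖ := by linarith
  have hσ1 : ‖γ t₀‖ < σ⁻¹ := by rw [lt_inv_comm₀ hn0 hσ0]; linarith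
  obtain ⟨t₁, ht₁, hlt⟩ := hγ.norm_unbounded hC hα hβ hγ0 σ⁻¹
  have h01 : t₀ ≤ t₁ := by
    by_contra! hlt'
    have h3 := norm_le_norm_of_le hC hα hβ h (Icc_subset_forwardInterval ht₁.1 ht₀) hlt'.le
    linarith
  have hsub1 := Icc_subset_forwardInterval ht₀.1 ht₁
  obtain ⟨a, ha, haσ⟩ := intermediate_value_Icc h01 (h.continuousOn.mono hsub1).norm
    ⟨hσ1.le, hlt.le⟩
  have haJ : a ∈ forwardInterval T ∩ Ici t₀ := ⟨hsub1 ha, ha.1⟩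
  obtain ⟨ψ, -, hψ0, hψ1⟩ := exists_pos_polar_angle p
  set φ := toIcoMod Real.two_pi_pos (θ a) ψ with hφ
  have hφm := toIcoMod_mem_Ico Real.two_pi_pos (θ a) ψ
  rw [← hφ] at hφm
  have hφk : φ = ψ - toIcoDiv Real.two_pi_pos (θ a) ψ * (2 * Real.pi) := by
    rw [hφ, toIcoMod, zsmul_eq_mul]
  have hcos : Real.cos φ = Real.cos ψ := by rw [hφk, Real.cos_sub_int_mul_two_pi]
  have hsin : Real.sin φ = Real.sin ψ := by rw [hφk, Real.sin_sub_int_mul_two_pi]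
  have hθa : θ t₀ ≤ θ a := hθ.strictMonoOn.monotoneOn ⟨ht₀, self_mem_Ici⟩ haJ ha.1
  obtain ⟨b, hbJ, hb⟩ : φ ∈ θ '' (forwardInterval T ∩ Ici t₀) := by
    rw [hθ.image_eq]; exact hθa.trans hφm.1
  have hab : a ≤ b := (hθ.strictMonoOn.le_iff_le haJ hbJ).1 (hb ▸ hφm.1)
  have hge := hθ.inv_norm_ge hC hα hβ hαβ h ht₀ h1 h2 ha.1 hab hbJ.1
  simp only at haσ
  rw [haσ, inv_inv] at hge
  have hsb : σ⁻¹ ≤ ‖γ b‖ :=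
    haσ ▸ norm_le_norm_of_le hC hα hβ h (Icc_subset_forwardInterval haJ.1.1 hbJ.1) hab
  have hbpos : 0 < ‖γ b‖ := (inv_pos.2 hσ0).trans_le hsb
  have hle : ‖γ b‖⁻¹ ≤ σ := inv_le_of_inv_le₀ hσ0 hsb
  refine ⟨_, ⟨_, ⟨b, hbJ.1, rfl⟩, rfl⟩, ?_⟩
  have hdist : dist p (geomInversion (γ b)) = σ - ‖γ b‖⁻¹ := by
    rw [dist_eq_norm, ← sq_eq_sq₀ (norm_nonneg _) (by linarith), EuclideanSpace.norm_sq_fin_two]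
    simp only [geomInversion, PiLp.sub_apply, PiLp.smul_apply, smul_eq_mul]
    rw [hθ.fst_eq b hbJ, hθ.snd_eq b hbJ, hψ0, hψ1, hb, hcos, hsin, ← hσ]
    have e : (‖γ b‖ ^ 2)⁻¹ * ‖γ b‖ = ‖γ b‖⁻¹ := by field_simp
    rw [← mul_assoc, ← mul_assoc, e]
    linear_combination (σ - ‖γ b‖⁻¹) ^ 2 * Real.cos_sq_add_sin_sq ψ
  rw [hdist]
  have hang : θ b - θ a ≤ 2 * Real.pi := by rw [hb]; linarith [hφm.2]
  calc σ - ‖γ b‖⁻¹ ≤ 2 * C * σ ^ (α + β) * (θ b - θ a) := by linarith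
    _ ≤ 2 * C * R ^ (α + β) * (2 * Real.pi) := by
        have : 0 ≤ R := hσ0.le.trans hp.le
        have : 0 ≤ θ b - θ a := by rw [hb]; linarith [hφm.1]
        gcongr
    _ = 4 * Real.pi * C * R ^ (α + β) := by ring
    _ < ε := hRε

theorem exists_volume_thickening_initial_le (hC : 0 < C) (hα : Even α) (hβ : Odd β)
    (hαβ : 1 < α + β)
    (h : IsIntegralCurveOn γ (fun _ => invertedOscillatorField C α β) (forwardInterval T))
    (hγ0 : γ 0 ≠ 0) {t₀ : ℝ} (ht₀ : t₀ ∈ forwardInterval T) :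
    ∃ M, 0 ≤ M ∧ ∀ ε > 0,
      volume (Metric.thickening ε ((fun t => geomInversion (γ t)) '' Icc 0 t₀)) ≤
        ENNReal.ofReal (4 * Real.pi * ε * M + 4 * Real.pi * ε ^ 2) := by
  set S := ‖γ t₀‖
  set M := 2 * S ^ (2 * (α + β) - 1) + 6 * C * S ^ (α + β) with hM
  have hM0 : 0 ≤ M := by positivity
  have hsub := Icc_subset_forwardInterval le_rfl ht₀
  have hlip : ∀ a ∈ Icc 0 t₀, ∀ b ∈ Icc 0 t₀, a ≤ b →
      dist (geomInversion (γ a)) (geomInversion (γ b)) ≤ |M * a - M * b| := by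
    intro a ha b hb hab
    have hI : Icc a b ⊆ Icc 0 t₀ := Icc_subset_Icc ha.1 hb.2
    have hne : ∀ t ∈ Icc a b, γ t ≠ 0 := fun t ht => ne_zero_of_le hC hα hβ h
      ((Icc_subset_Icc_right (hI ht).2).trans hsub) (hI ht).1 hγ0
    rw [dist_comm, abs_sub_comm, dist_eq_norm]
    refine (norm_sub_le_sub_of_hasDerivWithinAt (g := fun t : ℝ => M * t) (g' := fun _ => M)
      (hI.trans hsub)
      (fun t ht => hasDerivWithinAt_geomInversion h (hsub (hI ht)) (hne t ht))
      (fun t _ => by simpa using ((hasDerivAt_id t).const_mul M).hasDerivWithinAt)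
      (fun t ht => ?_) hab).trans (le_abs_self _)
    refine (norm_deriv_geomInversion_le hC hαβ (hne t ht)).trans ?_
    have : ‖γ t‖ ≤ S := norm_le_norm_of_le hC hα hβ h
      ((Icc_subset_Icc_left (hI ht).1).trans hsub) (hI ht).2
    rw [hM]
    gcongr
  refine ⟨M * t₀, mul_nonneg hM0 ht₀.1, fun ε hε => ?_⟩
  have := volume_thickening_image_le (S := Icc 0 t₀) (c := fun t => geomInversion (γ t))
    (g := fun t => M * t) (a := 0) (b := M * t₀) (ε := ε)
    (fun a ha b hb => by
      rcases le_total a b with hab | hab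
      · exact hlip a ha b hb hab
      · rw [dist_comm, abs_sub_comm]; exact hlip b hb a ha hab)
    (fun t ht => ⟨mul_nonneg hM0 ht.1, mul_le_mul_of_nonneg_left ht.2 hM0⟩)
    (mul_nonneg hM0 ht₀.1) hε
  rwa [sub_zero] at this

/-- A multiple of `arcLengthGauge` serves as the parameter in `volume_thickening_image_le`; it
differs from that multiple of r^(n-2) by a bounded amount. -/
theorem exists_volume_thickening_arc_le (hC : 0 < C) (hα : Even α) (hβ : Odd β)
    (hαβ : 1 < α + β)
    (h : IsIntegralCurveOn γ (fun _ => invertedOscillatorField C α β) (forwardInterval T))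
    {t₀ : ℝ} (ht₀ : t₀ ∈ forwardInterval T) (h1 : 1 ≤ ‖γ t₀‖) (h2 : 24 * C ≤ ‖γ t₀‖) :
    ∃ K κ, 0 ≤ K ∧ 0 ≤ κ ∧ ∀ ε > 0, ∀ r ≥ 0,
      volume (Metric.thickening ε ((fun t => geomInversion (γ t)) ''
        {t ∈ forwardInterval T ∩ Ici t₀ | ‖γ t‖ ≤ r})) ≤
        ENNReal.ofReal (4 * Real.pi * ε * (K * (r ^ (α + β - 2) + 2 * κ))
          + 4 * Real.pi * ε ^ 2) := by
  have hκ := arcLengthWeight_pos hC (α + β)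
  set κ := arcLengthWeight C (α + β) with hκd
  set K := 4 * (2 + 6 * C) / κ with hK
  have hK0 : 0 ≤ K := by positivity
  have hmono : ∀ t ∈ forwardInterval T ∩ Ici t₀, ‖γ t₀‖ ≤ ‖γ t‖ := fun t ht =>
    norm_le_norm_of_le hC hα hβ h (Icc_subset_forwardInterval ht₀.1 ht.1) ht.2
  have hlip : ∀ a ∈ forwardInterval T ∩ Ici t₀, ∀ b ∈ forwardInterval T ∩ Ici t₀, a ≤ b →
      dist (geomInversion (γ a)) (geomInversion (γ b)) ≤
        |K * arcLengthGauge C (α + β) (γ a) - K * arcLengthGauge C (α + β) (γ b)| :=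
    fun a ha b hb hab => by
      rw [abs_sub_comm]
      exact (dist_geomInversion_le hC hα hβ hαβ h (Icc_subset_forwardInterval ha.1.1 hb.1) hab
        (h1.trans (hmono a ha)) (h2.trans (hmono a ha))).trans (le_abs_self _)
  refine ⟨K, κ, hK0, hκ.le, fun ε hε r hr => ?_⟩
  have := volume_thickening_image_le (S := {t ∈ forwardInterval T ∩ Ici t₀ | ‖γ t‖ ≤ r})
    (c := fun t => geomInversion (γ t)) (g := fun t => K * arcLengthGauge C (α + β) (γ t))
    (a := K * (-κ)) (b := K * (r ^ (α + β - 2) + κ)) (ε := ε)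
    (fun a ha b hb => by
      rcases le_total a b with hab | hab
      · exact hlip a ha.1 b hb.1 hab
      · rw [dist_comm, abs_sub_comm]; exact hlip b hb.1 a ha.1 hab)
    (fun t ht => by
      have h3 := abs_le.1 (abs_arcLengthGauge_sub_le hC (α + β) (h1.trans (hmono t ht.1)))
      have h4 : ‖γ t‖ ^ (α + β - 2) ≤ r ^ (α + β - 2) := by
        have := ht.2; gcongr
      have h5 : 0 ≤ ‖γ t‖ ^ (α + β - 2) := by positivity
      exact ⟨mul_le_mul_of_nonneg_left (by linarith [h3.1]) hK0,
        mul_le_mul_of_nonneg_left (by linarith [h3.2]) hK0⟩)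
    (mul_le_mul_of_nonneg_left (by linarith [pow_nonneg hr (α + β - 2)]) hK0) hε
  refine this.trans_eq ?_
  congr 2
  ring

/-- Three pieces are covered at scale ε = R^n: the initial arc costs O(ε), the arc outside radius R
costs O(ε R^(2-n)), and the tail lies in the disc of radius R. Each is O(R²). -/
theorem exists_volume_thickening_le (hC : 0 < C) (hα : Even α) (hβ : Odd β) (hαβ : 1 < α + β)
    (h : IsIntegralCurveOn γ (fun _ => invertedOscillatorField C α β) (forwardInterval T))
    (hγ0 : γ 0 ≠ 0)
    {t₀ : ℝ} (ht₀ : t₀ ∈ forwardInterval T) (h1 : 1 ≤ ‖γ t₀‖) (h2 : 24 * C ≤ ‖γ t₀‖) :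
    ∃ K, ∀ R ∈ Ioo (0 : ℝ) 1,
      volume (Metric.thickening (R ^ (α + β)) (geomInversion '' (γ '' forwardInterval T))) ≤
        ENNReal.ofReal (K * R ^ 2) := by
  obtain ⟨M, hM0, hM⟩ := exists_volume_thickening_initial_le hC hα hβ hαβ h hγ0 ht₀
  obtain ⟨K, κ, hK0, hκ0, hK⟩ := exists_volume_thickening_arc_le hC hα hβ hαβ h ht₀ h1 h2
  refine ⟨4 * Real.pi * M + 4 * Real.pi + (4 * Real.pi * (K * (1 + 2 * κ)) + 4 * Real.pi)
    + 4 * Real.pi, fun R hR => ?_⟩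
  obtain ⟨k, hk⟩ : ∃ k, α + β = k + 2 := ⟨α + β - 2, by omega⟩
  have hR0 := hR.1
  set ε := R ^ (α + β) with hεd
  have hε : 0 < ε := by positivity
  have hεR2 : ε ≤ R ^ 2 := pow_le_pow_of_le_one hR0.le hR.2.le (by omega)
  have hR2 : R ^ 2 ≤ R := by nlinarith [hR.2]
  have hε2 : ε ^ 2 ≤ R ^ 2 := by gcongr; linarith
  have hεR : ε * R⁻¹ ^ (α + β - 2) = R ^ 2 := by
    rw [hεd, hk, Nat.add_sub_cancel, inv_pow, pow_add]; field_simp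
  set w := fun t => geomInversion (γ t) with hw
  have hcover : geomInversion '' (γ '' forwardInterval T) ⊆
      (w '' Icc 0 t₀ ∪ w '' {t ∈ forwardInterval T ∩ Ici t₀ | ‖γ t‖ ≤ R⁻¹}) ∪
        Metric.ball 0 R := by
    rintro _ ⟨_, ⟨t, ht, rfl⟩, rfl⟩
    rcases le_total t t₀ with h3 | h3
    · exact .inl (.inl ⟨t, ⟨ht.1, h3⟩, rfl⟩)
    rcases le_or_gt ‖γ t‖ R⁻¹ with h4 | h4
    · exact .inl (.inr ⟨t, ⟨⟨ht, h3⟩, h4⟩, rfl⟩)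
    · right
      rw [mem_ball_zero_iff, norm_geomInversion]
      exact inv_lt_of_inv_lt₀ hR0 h4
  have hball : volume (Metric.thickening ε (Metric.ball (0 : EuclideanSpace ℝ (Fin 2)) R)) ≤
      ENNReal.ofReal (4 * Real.pi * R ^ 2) := by
    rw [thickening_ball hε hR0, EuclideanSpace.volume_ball_fin_two,
      ← ENNReal.ofReal_pow (by positivity), ← ENNReal.ofReal_mul (by positivity)]
    refine ENNReal.ofReal_le_ofReal ?_
    calc (ε + R) ^ 2 * Real.pi ≤ (R + R) ^ 2 * Real.pi := by gcongr; linarith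
      _ = _ := by ring
  have hpi := Real.pi_pos
  calc _ ≤ volume (Metric.thickening ε _) :=
        measure_mono (Metric.thickening_subset_of_subset _ hcover)
    _ ≤ _ := volume_thickening_union_le ε
    _ ≤ _ := add_le_add ((volume_thickening_union_le ε).trans
        (add_le_add (hM ε hε) (hK ε hε R⁻¹ (by positivity)))) hball
    _ = ENNReal.ofReal ((4 * Real.pi * ε * M + 4 * Real.pi * ε ^ 2)
          + (4 * Real.pi * ε * (K * (R⁻¹ ^ (α + β - 2) + 2 * κ)) + 4 * Real.pi * ε ^ 2)
          + 4 * Real.pi * R ^ 2) := by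
        rw [← ENNReal.ofReal_add (by positivity) (by positivity),
          ← ENNReal.ofReal_add (by positivity) (by positivity)]
    _ ≤ _ := ENNReal.ofReal_le_ofReal ?_
  have e1 : 4 * Real.pi * ε * (K * (R⁻¹ ^ (α + β - 2) + 2 * κ)) =
      4 * Real.pi * (K * (R ^ 2 + ε * (2 * κ))) := by rw [← hεR]; ring
  rw [e1]
  calc _ ≤ (4 * Real.pi * R ^ 2 * M + 4 * Real.pi * R ^ 2)
          + (4 * Real.pi * (K * (R ^ 2 + R ^ 2 * (2 * κ))) + 4 * Real.pi * R ^ 2)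
          + 4 * Real.pi * R ^ 2 := by gcongr
    _ = _ := by ring

end Volume

/-! ### Change of scale ε = R^n and conclusion -/

theorem eventually_rpow_inv {n : ℕ} (hn : n ≠ 0) {P : ℝ → ℝ → ℝ → Prop}
    (h : ∀ R ∈ Ioo (0 : ℝ) 1, P R (R ^ n) (R ^ 2)) :
    ∀ᶠ ε in 𝓝[>] (0 : ℝ), P (ε ^ (n : ℝ)⁻¹) ε (ε ^ (2 - 2 * (1 - 1 / (n : ℝ)))) := by
  have hn' : (0 : ℝ) < n := by positivity
  filter_upwards [Ioo_mem_nhdsGT (zero_lt_one' ℝ)] with ε hε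
  have := h (ε ^ (n : ℝ)⁻¹) ⟨Real.rpow_pos_of_pos hε.1 _,
    Real.rpow_lt_one hε.1.le hε.2 (by positivity)⟩
  rw [Real.rpow_inv_natCast_pow hε.1.le hn, ← Real.rpow_natCast (ε ^ _) 2,
    ← Real.rpow_mul hε.1.le] at this
  convert this using 2
  push_cast
  ring

theorem theorem3p1 (C : ℝ) (hC : 0 < C) (α β : ℕ) (hα : Even α) (hβ : Odd β)
    (hαβ : 1 < α + β) (T : EReal) (γ : ℝ → EuclideanSpace ℝ (Fin 2))
    (hγ : IsMaximalForwardSolution (invertedOscillatorField C α β) T γ)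
    (hγ0 : γ 0 ≠ 0) :
    IsSpiralConvergingToInfinity T γ ∧
    HasBoxDimAtInfinity (γ '' forwardInterval T) (2 * (1 - 1 / ((α : ℝ) + (β : ℝ)))) ∧
    IsMinkowskiNondegenerateAtInfinity (γ '' forwardInterval T) := by
  have h := hγ.solution
  obtain ⟨t₀, ht₀, hlarge⟩ := hγ.norm_unbounded hC hα hβ hγ0 (max 1 (24 * C))
  have h1 : 1 ≤ ‖γ t₀‖ := (le_max_left _ _).trans hlarge.le
  have h24 : 24 * C ≤ ‖γ t₀‖ := (le_max_right _ _).trans hlarge.le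
  have h2 : 2 * C ≤ ‖γ t₀‖ := by linarith
  have hn0 : 0 < ‖γ t₀‖ := by linarith
  obtain ⟨θ, hθ⟩ := exists_isPolarAngle hC hα hβ hαβ hγ hγ0 ht₀ h1 h2
  have hinf : IsUnboundedAwayFromOrigin (γ '' forwardInterval T) := by
    refine ⟨fun hb => ?_, ‖γ 0‖, norm_pos_iff.2 hγ0, ?_⟩
    · obtain ⟨R, hR⟩ := hb.exists_norm_le
      obtain ⟨t, ht, htR⟩ := hγ.norm_unbounded hC hα hβ hγ0 R
      exact htR.not_ge (hR _ (mem_image_of_mem γ ht))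
    · rintro _ ⟨t, ht, rfl⟩
      exact norm_le_norm_of_le hC hα hβ h (Icc_subset_forwardInterval le_rfl ht) ht.1
  obtain ⟨K, hK⟩ := exists_volume_thickening_le hC hα hβ hαβ h hγ0 ht₀ h1 h24
  set A := geomInversion '' (γ '' forwardInterval T) with hA
  have hpi := Real.pi_pos
  -- The first bound keeps the disc of radius cR within the radius of the inverted curve at t₀; the
  -- second, with c^n ≤ c, makes the drop over one turn less than R^n.
  set c := min ‖γ t₀‖⁻¹ (1 + 4 * Real.pi * C)⁻¹ with hc
  have hc0 : 0 < c := by positivity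
  have hc1 : c ≤ 1 := (min_le_left _ _).trans (inv_le_one_of_one_le₀ h1)
  have hcC : 4 * Real.pi * C * c < 1 := by
    have h3 : c ≤ (1 + 4 * Real.pi * C)⁻¹ := min_le_right _ _
    rw [le_inv_comm₀ hc0 (by positivity), le_inv_comm₀ (by positivity) hc0,
      ← one_div, le_div_iff₀ (by positivity)] at h3
    linarith
  have hlow : ∀ R ∈ Ioo (0 : ℝ) 1, ENNReal.ofReal (c ^ 2 * Real.pi * R ^ 2) ≤
      volume (Metric.thickening (R ^ (α + β)) A) := fun R hR => by
    have hR0 := hR.1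
    have hsub : Metric.ball 0 (c * R) ⊆ Metric.thickening (R ^ (α + β)) A := by
      refine hθ.ball_subset_thickening hC hα hβ hαβ hγ hγ0 ht₀ h1 h2 ?_ (by positivity) ?_
      · exact (mul_le_of_le_one_right hc0.le hR.2.le).trans (min_le_left _ _)
      · have h3 : c ^ (α + β) ≤ c := pow_le_of_le_one hc0.le hc1 (by omega)
        calc 4 * Real.pi * C * (c * R) ^ (α + β)
            = 4 * Real.pi * C * c ^ (α + β) * R ^ (α + β) := by rw [mul_pow]; ring
          _ ≤ 4 * Real.pi * C * c * R ^ (α + β) := by gcongr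
          _ < 1 * R ^ (α + β) := by gcongr
          _ = _ := one_mul _
    refine le_trans (le_of_eq ?_) (measure_mono hsub)
    rw [EuclideanSpace.volume_ball_fin_two, ← ENNReal.ofReal_pow (by positivity),
      ← ENNReal.ofReal_mul (by positivity)]
    congr 1
    ring
  have hn : α + β ≠ 0 := by omega
  have hlow' := eventually_rpow_inv hn (P := fun _ ε S =>
    ENNReal.ofReal (c ^ 2 * Real.pi * S) ≤ volume (Metric.thickening ε A)) hlow
  have hup' := eventually_rpow_inv hn (P := fun _ ε S =>
    volume (Metric.thickening ε A) ≤ ENNReal.ofReal (K * S)) hK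
  have hd : (0 : ℝ) ≤ 2 * (1 - 1 / ((α + β : ℕ) : ℝ)) := by
    have h3 : (1 : ℝ) ≤ ((α + β : ℕ) : ℝ) := by exact_mod_cast hαβ.le
    have h4 : 1 / ((α + β : ℕ) : ℝ) ≤ 1 := by
      rw [div_le_one (by linarith)]; exact h3
    linarith
  obtain ⟨hu, hl, hm⟩ := boxDim_eq_of_volume_bounds hd (by positivity) hlow' hup'
  rw [Nat.cast_add] at hu hl
  refine ⟨⟨fun R => ?_, t₀, ht₀, hθ.isPolarSpiralToInfinity hC hα hβ hγ hγ0 ht₀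
    (norm_pos_iff.1 hn0)⟩, ⟨hinf, hu, hl⟩, hinf, hm⟩
  obtain ⟨t, ht, htR⟩ := hγ.norm_unbounded hC hα hβ hγ0 R
  exact ⟨t, ht, fun s hs hts => htR.le.trans
    (norm_le_norm_of_le hC hα hβ h (Icc_subset_forwardInterval ht.1 hs) hts)⟩
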